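/- Let $A$ be a CW-complex. Every continuous map $f\colon A \to B$ to a topological space $B$ has a factorization $$A \xrightarrow{\;j\;} \widetilde{B} \xrightarrow{\;p\;} B,\qquad p\circ j=f,$$ in which $\widetilde{B}$ is a CW-complex, $j$ is the inclusion of a subcomplex, and $p$ is a weak equivalence (a bijection on path components and, for every choice of basepoint, an isomorphism on all homotopy groups). The factorization is functorial with respect to commutative squares whose top map is cellular: to every commutative square $$\begin{array}{ccc} A & \xrightarrow{\;h\;} & A' \\ {\scriptstyle f}\downarrow & & \downarrow{\scriptstyle f'} \\ B & \xrightarrow{\;g\;} & B' \end{array}$$ in which $h$ is a cellular map of CW-complexes and $g$ is continuous there is assigned a continuous map $\tilde g\colon \widetilde{B}\to\widetilde{B}'$ with $\tilde g\circ j=j'\circ h$ and $p'\circ\tilde g=g\circ p$, compatibly with identities and composition of squares. Moreover, the factorization can be chosen so that, for every $f$, $\widetilde{B}$ is obtained from $A$ by attaching exactly the following cells. For $n\ge 0$ let $A_{n-1}\subseteq\widetilde{B}$ be the union of $j(A)$ and all cells of $\widetilde{B}$ of dimension less than $n$ (so $A_{-1}=j(A)$). Then each $n$-cell of $\widetilde{B}$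 not in $j(A)$, with characteristic map $\Phi\colon D^n\to\widetilde{B}$, is assigned the pair $(\Phi|_{S^{n-1}},\,p\circ\Phi)$, and this is a bijection from the set of these $n$-cells onto the set of pairs of continuous maps $\alpha\colon S^{n-1}\to A_{n-1}$, $\beta\colon D^n\to B$ such that $p\circ\alpha=\beta|_{S^{n-1}}$ and $\alpha$ is cellular, meaning that $\alpha(S^{n-1})$ is contained in the $(n-1)$-skeleton. (For $n=0$ the sphere is empty, and there is one new $0$-cell for each point of $B$.) -/

import Mathlib

open CategoryTheory Topology

universe u

namespace CellularFactorization

/-- The map `π₀(X) → π₀(Y)` on path components induced by a continuous map. -/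
def zerothHomotopyMap {X Y : Type*} [TopologicalSpace X] [TopologicalSpace Y] (f : C(X, Y)) :
    ZerothHomotopy X → ZerothHomotopy Y :=
  Quotient.map f (fun _ _ h => h.map f.continuous)

/-- Postcomposition of a based map `(Iⁿ, ∂Iⁿ) → (X, x)` with a continuous map `f : X → Y`. -/
def genLoopMap {X Y : Type*} [TopologicalSpace X] [TopologicalSpace Y] (f : C(X, Y))
    (n : ℕ) (x : X) (γ : GenLoop (Fin n) X x) : GenLoop (Fin n) Y (f x) :=
  ⟨f.comp γ.1, fun y hy => congrArg f (γ.2 y hy)⟩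

/-- The map `πₙ(X, x) → πₙ(Y, f x)` induced by a continuous map `f : X → Y`. -/
def homotopyGroupMap {X Y : Type*} [TopologicalSpace X] [TopologicalSpace Y] (f : C(X, Y))
    (n : ℕ) (x : X) : HomotopyGroup.Pi n X x → HomotopyGroup.Pi n Y (f x) :=
  Quotient.map (genLoopMap f n x)
    (fun _ _ h => ContinuousMap.HomotopicRel.comp_continuousMap h f)

/-- A weak (homotopy) equivalence: a continuous map which induces a bijection on path components
and, for every choice of basepoint, bijections (hence isomorphisms) on all homotopy groups. -/
def IsWeakEquivalence {X Y : Type*} [TopologicalSpace X] [TopologicalSpace Y]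
    (f : C(X, Y)) : Prop :=
  Function.Bijective (zerothHomotopyMap f) ∧
    ∀ (n : ℕ) (x : X), 1 ≤ n → Function.Bijective (homotopyGroupMap f n x)

/-- A continuous map of CW complexes is cellular if it maps the `n`-skeleton to the `n`-skeleton
for every `n`. -/
def IsCellular {X Y : Type*} [TopologicalSpace X] [TopologicalSpace Y] [T2Space X] [T2Space Y]
    [CWComplex (Set.univ : Set X)] [CWComplex (Set.univ : Set Y)] (f : C(X, Y)) : Prop :=
  ∀ n : ℕ, Set.MapsTo f (RelCWComplex.skeleton (Set.univ : Set X) n : Set X)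
    (RelCWComplex.skeleton (Set.univ : Set Y) n : Set Y)

/-- The map `j : A → X` of CW complexes is the inclusion of a subcomplex: it is a closed embedding
onto (the underlying space of) a subcomplex `E` of `X`, and it identifies the cells of `A`,
together with their characteristic maps, with the cells of `E`. -/
def IsSubcomplexInclusion {A X : Type*} [TopologicalSpace A] [TopologicalSpace X]
    [CWComplex (Set.univ : Set A)] [CWComplex (Set.univ : Set X)] (j : C(A, X)) : Prop :=
  IsClosedEmbedding j ∧
    ∃ E : RelCWComplex.Subcomplex (Set.univ : Set X), (E : Set X) = Set.range j ∧
      ∃ e : ∀ n : ℕ, RelCWComplex.cell (Set.univ : Set A) n ≃ E.I n,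
        ∀ (n : ℕ) (i : RelCWComplex.cell (Set.univ : Set A) n),
          ∀ x ∈ Metric.closedBall (0 : Fin n → ℝ) 1,
            RelCWComplex.map (C := (Set.univ : Set X)) n (e n i).1 x = j (RelCWComplex.map n i x)

/-- For a map `j : A → X` onto a subcomplex, `stageLT j n` is the union of `j(A)` and the cells of
`X` of dimension less than `n`, i.e. the space (usually written `A_{n-1}`) to which the `n`-cells
of `X` outside `A` are attached. In particular `stageLT j 0` is `j(A)`. -/
def stageLT {A X : Type*} [TopologicalSpace A] [TopologicalSpace X] [T2Space X]
    [CWComplex (Set.univ : Set X)] (j : C(A, X)) (n : ℕ) : Set X :=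
  Set.range j ∪ (RelCWComplex.skeletonLT (Set.univ : Set X) n : Set X)

/-- A commutative square
```
  S^{n-1} --α--> A_{n-1}
    |               |
    v               v p
   D^n  ----β---->  B
```
whose top map `α` is cellular, i.e. (`S^{n-1}` being `(n-1)`-dimensional) takes values in the
`(n-1)`-skeleton. The disk `D^n` is the closed unit ball used for characteristic maps of cells.
For `n = 0` the sphere is empty and such a square is just a map `D^0 → B`. -/
structure CellularSquare {A X B : Type*} [TopologicalSpace A] [TopologicalSpace X] [T2Space X]
    [TopologicalSpace B] [CWComplex (Set.univ : Set X)] (j : C(A, X)) (p : C(X, B)) (n : ℕ) where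
  /-- the attaching map -/
  α : C(Metric.sphere (0 : Fin n → ℝ) 1, stageLT j n)
  /-- the map on the disk -/
  β : C(Metric.closedBall (0 : Fin n → ℝ) 1, B)
  cellular : ∀ x, (α x : X) ∈ RelCWComplex.skeletonLT (Set.univ : Set X) n
  comm : ∀ x : Metric.sphere (0 : Fin n → ℝ) 1,
    p (α x) = β ⟨x, Metric.sphere_subset_closedBall x.2⟩

/-- The `n`-cell `i` of `X` is attached along the square `s`: its characteristic map restricts to
`s.α` on the boundary sphere, and `p` maps the cell to `B` by `s.β`. -/
def IsAttachedAlong {A X B : Type*} [TopologicalSpace A] [TopologicalSpace X] [T2Space X]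
    [TopologicalSpace B] [CWComplex (Set.univ : Set X)] {j : C(A, X)} {p : C(X, B)} {n : ℕ}
    (i : RelCWComplex.cell (Set.univ : Set X) n) (s : CellularSquare j p n) : Prop :=
  (∀ x : Metric.sphere (0 : Fin n → ℝ) 1, RelCWComplex.map n i x = (s.α x : X)) ∧
    ∀ x : Metric.closedBall (0 : Fin n → ℝ) 1, p (RelCWComplex.map n i x) = s.β x

/-- The `n`-cells of `X` which do not belong to the subcomplex `j(A)`. -/
def NewCell {A X : Type*} [TopologicalSpace A] [TopologicalSpace X]
    [CWComplex (Set.univ : Set X)] (j : C(A, X)) (n : ℕ) : Type _ :=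
  {i : RelCWComplex.cell (Set.univ : Set X) n // Disjoint (RelCWComplex.openCell n i) (Set.range j)}

/-- `X` arises from `A` by attaching, in each dimension `n`, exactly one `n`-cell for each
cellular square: every new cell is attached along a unique cellular square, and along every
cellular square exactly one new cell is attached. -/
def AttachesExactlyCellularSquares {A X B : Type*} [TopologicalSpace A] [TopologicalSpace X]
    [T2Space X] [TopologicalSpace B] [CWComplex (Set.univ : Set X)]
    (j : C(A, X)) (p : C(X, B)) : Prop :=
  ∀ n : ℕ, (∀ i : NewCell j n, ∃! s : CellularSquare j p n, IsAttachedAlong i.1 s) ∧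
    ∀ s : CellularSquare j p n, ∃! i : NewCell j n, IsAttachedAlong i.1 s

/-- A continuous map `f : A → B` from a (Hausdorff) CW complex `A` to a topological space `B`. -/
structure MapFromCW where
  A : Type u
  B : Type u
  [topA : TopologicalSpace A]
  [topB : TopologicalSpace B]
  [t2A : T2Space A]
  [cwA : CWComplex (Set.univ : Set A)]
  f : C(A, B)

attribute [instance] MapFromCW.topA MapFromCW.topB MapFromCW.t2A MapFromCW.cwA

/-- A commutative square from `f : A → B` to `f' : A' → B'` whose top map `A → A'` is cellular. -/
@[ext]
structure MapFromCW.Hom (φ ψ : MapFromCW.{u}) where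
  top : C(φ.A, ψ.A)
  bot : C(φ.B, ψ.B)
  cellular : IsCellular top
  comm : ψ.f.comp top = bot.comp φ.f

/-- The category of maps from CW complexes to spaces, with squares with cellular top map. -/
instance : Category MapFromCW.{u} where
  Hom := MapFromCW.Hom
  id φ := ⟨ContinuousMap.id _, ContinuousMap.id _, fun _ _ hx => hx, rfl⟩
  comp {φ ψ χ} σ τ := ⟨τ.top.comp σ.top, τ.bot.comp σ.bot,
    fun n _ hx => τ.cellular n (σ.cellular n hx), by
      rw [← ContinuousMap.comp_assoc, τ.comm, ContinuousMap.comp_assoc, σ.comm,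
        ContinuousMap.comp_assoc]⟩

/-- The functor taking `f : A → B` to the space `A`. -/
def domFunctor : MapFromCW.{u} ⥤ TopCat.{u} where
  obj φ := TopCat.of φ.A
  map σ := TopCat.ofHom σ.top

/-- The functor taking `f : A → B` to the space `B`. -/
def codFunctor : MapFromCW.{u} ⥤ TopCat.{u} where
  obj φ := TopCat.of φ.B
  map σ := TopCat.ofHom σ.bot

/-- The tautological natural transformation, whose component at `f : A → B` is `f`. -/
def tautological : domFunctor.{u} ⟶ codFunctor.{u} where
  app φ := TopCat.ofHom φ.f
  naturality _ _ σ := congrArg TopCat.ofHom σ.comm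

/-- The continuous map `A → X` underlying a morphism from `domFunctor.obj φ`. -/
def fromA {φ : MapFromCW.{u}} {X : TopCat.{u}} (j : domFunctor.obj φ ⟶ X) : C(φ.A, X) := j.hom

/-- The continuous map `X → B` underlying a morphism to `codFunctor.obj φ`. -/
def toB {φ : MapFromCW.{u}} {X : TopCat.{u}} (p : X ⟶ codFunctor.obj φ) : C(X, φ.B) := p.hom

end CellularFactorization

/-! ### Formal points, formal cells and their topology -/

namespace CellularFactorization

open Metric Set

/-! The space is built by gluing on, in each dimension n, one n-cell for every cellular square. A
cellular square is a pair of functions, so a point of the result can be written as a term: a point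
of `A`, or an interior point of a disk labelled by an attaching function into terms and a function
to `B`. All terms exist at once. The cells that belong to the space are singled out by recursion on
dimension (`MapFromCW.cells`), and the topology is the final one for `A` and the characteristic
functions. A commutative square acts by substitution in terms, so functoriality holds strictly, and
the bijection between new cells and cellular squares amounts to equality of labels.

That `Total φ` is a CW complex needs two arguments: points are separated by open sets thickened
along collars of the higher cells, and an attaching map meets only finitely many cells by
compactness (`finite_boundaryCells`).

The projection is a weak equivalence because disks with prescribed boundary lift along it up to
homotopy rel boundary (`LiftsDisks`). Given a sphere in the total space whose image bounds a disk in
`B`, cellular approximation (`exists_homotopic_skeletonLT`) deforms the sphere into the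
(n-1)-skeleton, and the deformation is absorbed in a collar of the disk
(`exists_lift_of_homotopic`). The new boundary and disk form a cellular square, and the
characteristic map of the cell attached along it is a strict lift. Disk lifting in dimension n gives
surjectivity on πₙ, and in dimension n + 1 injectivity. -/

/-- Formal points of a space obtained from `A` by attaching cells over `B`: a formal point is either
a point of `A` or an interior point of a formal cell, which is given by an attaching function into
formal points and a function from the disk to `B`. -/
inductive FormalPoint (A B : Type u) : Type u
  | base (a : A) : FormalPoint A B
  | cell (n : ℕ) (attach : sphere (0 : Fin n → ℝ) 1 → FormalPoint A B)
      (disk : closedBall (0 : Fin n → ℝ) 1 → B) (x : ball (0 : Fin n → ℝ) 1) : FormalPoint A B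

/-- A formal `n`-cell. -/
@[ext]
structure FormalCell (A B : Type u) (n : ℕ) where
  /-- the attaching function -/
  attach : sphere (0 : Fin n → ℝ) 1 → FormalPoint A B
  /-- the function on the disk -/
  disk : closedBall (0 : Fin n → ℝ) 1 → B

namespace FormalCell

variable {A B : Type u} {n : ℕ}

/-- The interior point of a formal cell with the given coordinates. -/
def point (c : FormalCell A B n) (x : ball (0 : Fin n → ℝ) 1) : FormalPoint A B :=
  .cell n c.attach c.disk x

open Classical in
/-- The characteristic function of a formal cell, with a junk value outside of the disk. -/
noncomputable def charMap (c : FormalCell A B n) (x : Fin n → ℝ) : FormalPoint A B :=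
  if h : x ∈ sphere (0 : Fin n → ℝ) 1 then c.attach ⟨x, h⟩ else
    if h : x ∈ ball (0 : Fin n → ℝ) 1 then c.point ⟨x, h⟩ else c.point ⟨0, by simp⟩

lemma charMap_sphere (c : FormalCell A B n) (x : sphere (0 : Fin n → ℝ) 1) :
    c.charMap x = c.attach x := by
  simp [charMap]

lemma charMap_ball (c : FormalCell A B n) (x : ball (0 : Fin n → ℝ) 1) :
    c.charMap x = c.point x := by
  have := ne_of_lt (mem_ball_zero_iff.1 x.2)
  simp [charMap, this]

lemma point_injective (c : FormalCell A B n) : Function.Injective c.point := by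
  intro x y h
  injection h

end FormalCell

variable {A B : Type u} [TopologicalSpace A]

/-- The topology on formal points generated by `A` and the characteristic functions of a
collection of formal cells. -/
noncomputable abbrev cellsTopology (S : ∀ n, Set (FormalCell A B n)) :
    TopologicalSpace (FormalPoint A B) :=
  .coinduced .base inferInstance ⊔
    ⨆ (n) (c : S n), .coinduced (fun x : closedBall (0 : Fin n → ℝ) 1 => c.1.charMap x) inferInstance

lemma isOpen_cellsTopology_iff {S : ∀ n, Set (FormalCell A B n)} {Z : Set (FormalPoint A B)} :
    IsOpen[cellsTopology S] Z ↔ IsOpen (FormalPoint.base ⁻¹' Z) ∧ ∀ n, ∀ c ∈ S n,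
      IsOpen {x : closedBall (0 : Fin n → ℝ) 1 | c.charMap x ∈ Z} := by
  have (t₁ t₂ : TopologicalSpace (FormalPoint A B)) :
      IsOpen[t₁ ⊔ t₂] Z ↔ IsOpen[t₁] Z ∧ IsOpen[t₂] Z := Iff.rfl
  rw [this]
  simp only [isOpen_iSup_iff, isOpen_coinduced, Subtype.forall]
  rfl

lemma isClosed_cellsTopology_iff {S : ∀ n, Set (FormalCell A B n)} {Z : Set (FormalPoint A B)} :
    IsClosed[cellsTopology S] Z ↔ IsClosed (FormalPoint.base ⁻¹' Z) ∧ ∀ n, ∀ c ∈ S n,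
      IsClosed {x : closedBall (0 : Fin n → ℝ) 1 | c.charMap x ∈ Z} := by
  rw [← @isOpen_compl_iff _ _ (cellsTopology S), isOpen_cellsTopology_iff, preimage_compl,
    isOpen_compl_iff]
  exact and_congr_right fun _ => forall₃_congr fun n c _ => isOpen_compl_iff

lemma cellsTopology_mono {S T : ∀ n, Set (FormalCell A B n)} (h : ∀ n, S n ⊆ T n) :
    cellsTopology S ≤ cellsTopology T := by
  rw [TopologicalSpace.le_def]
  intro Z (hZ : IsOpen[cellsTopology T] Z)
  rw [isOpen_cellsTopology_iff] at hZ ⊢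
  exact ⟨hZ.1, fun n c hc => hZ.2 n c (h n hc)⟩

/-- The formal points over a filtration `K` of `A` which lie in `K n` or in a cell in `S` of dimension
less than `n`. -/
def formalSkeletonLT (K : ℕ → Set A) (S : ∀ n, Set (FormalCell A B n)) (n : ℕ) :
    Set (FormalPoint A B) :=
  {P | match P with
    | .base a => a ∈ K n
    | .cell m α β _ => m < n ∧ ⟨α, β⟩ ∈ S m}

/-- The projection of formal points to `B`. -/
def FormalPoint.proj (f : A → B) : FormalPoint A B → B
  | .base a => f a
  | .cell _ _ β x => β ⟨x, ball_subset_closedBall x.2⟩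

/-- The points of `A` in the skeleta. -/
def MapFromCW.skel (φ : MapFromCW.{u}) (n : ℕ) : Set φ.A :=
  (RelCWComplex.skeletonLT (Set.univ : Set φ.A) n : Set φ.A)

/-- The `n`-cells of the factorization of `φ`: those formal cells which correspond to cellular
squares. -/
def MapFromCW.cells (φ : MapFromCW.{u}) : ∀ n, Set (FormalCell φ.A φ.B n)
  | n => {c |
      -- The attaching function lands in cells of smaller dimension, so the topology they generate
      -- suffices to state its continuity. The existential over `m < n` is a conjunction that makes
      -- the inequality available to the termination check.
      Continuous[inferInstance, cellsTopology fun m => {d | ∃ _ : m < n, d ∈ MapFromCW.cells φ m}]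
        c.attach ∧ Continuous c.disk ∧
      (∀ y, c.attach y ∈ formalSkeletonLT φ.skel
        (fun m => {d | ∃ _ : m < n, d ∈ MapFromCW.cells φ m}) n) ∧
      ∀ y, (c.attach y).proj φ.f = c.disk ⟨y, sphere_subset_closedBall y.2⟩}
  termination_by n => n

/-- The cells of the factorization of dimension less than `k`. -/
def MapFromCW.cellsLT (φ : MapFromCW.{u}) (k n : ℕ) : Set (FormalCell φ.A φ.B n) :=
  {d | n < k ∧ d ∈ φ.cells n}

lemma MapFromCW.mem_cells_iff' {φ : MapFromCW.{u}} {n : ℕ} {c : FormalCell φ.A φ.B n} :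
    c ∈ φ.cells n ↔ Continuous[inferInstance, cellsTopology (φ.cellsLT n)] c.attach ∧
      Continuous c.disk ∧ (∀ y, c.attach y ∈ formalSkeletonLT φ.skel φ.cells n) ∧
      ∀ y, (c.attach y).proj φ.f = c.disk ⟨y, sphere_subset_closedBall y.2⟩ := by
  have h1 : (fun m => {d | ∃ _ : m < n, d ∈ MapFromCW.cells φ m}) = φ.cellsLT n := by
    ext m d; simp [cellsLT]
  have h2 : formalSkeletonLT φ.skel (φ.cellsLT n) n = formalSkeletonLT φ.skel φ.cells n := by
    ext (a | ⟨m, α, β, x⟩)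
    · rfl
    · simp only [formalSkeletonLT, cellsLT, mem_ofPred_eq]; tauto
  rw [cells, h1, h2]
  rfl

end CellularFactorization

/-! ### Stages, the total space and functoriality -/

namespace CellularFactorization

open Metric Set

namespace MapFromCW

variable {φ : MapFromCW.{u}}

/-- The points of `A` and of all cells of the factorization of dimension less than `k`. -/
def stage (φ : MapFromCW.{u}) (k : ℕ) : Set (FormalPoint φ.A φ.B) :=
  formalSkeletonLT (fun _ => univ) φ.cells k

/-- The points of the factorization of `φ`. -/
def points (φ : MapFromCW.{u}) : Set (FormalPoint φ.A φ.B) :=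
  {P | match P with
    | .base _ => True
    | .cell m α β _ => ⟨α, β⟩ ∈ φ.cells m}

lemma skel_mono {m n : ℕ} (h : m ≤ n) : φ.skel m ⊆ φ.skel n :=
  RelCWComplex.skeletonLT_mono (by exact_mod_cast h)

lemma formalSkeletonLT_subset_stage (n : ℕ) :
    formalSkeletonLT φ.skel φ.cells n ⊆ φ.stage n := by
  rintro (a | ⟨m, α, β, x⟩) h
  · trivial
  · exact h

lemma formalSkeletonLT_mono {K : ℕ → Set φ.A} (hK : Monotone K)
    {S : ∀ n, Set (FormalCell φ.A φ.B n)} {m n : ℕ} (h : m ≤ n) :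
    formalSkeletonLT K S m ⊆ formalSkeletonLT K S n := by
  rintro (a | ⟨m, α, β, x⟩) hP
  · exact hK h hP
  · exact ⟨hP.1.trans_le h, hP.2⟩

lemma stage_mono {m n : ℕ} (h : m ≤ n) : φ.stage m ⊆ φ.stage n :=
  formalSkeletonLT_mono (fun _ _ _ => le_rfl) h

lemma stage_subset_points (n : ℕ) : φ.stage n ⊆ φ.points := by
  rintro (a | ⟨m, α, β, x⟩) h
  · trivial
  · exact h.2

lemma attach_mem_formalSkeletonLT {n : ℕ} {c : FormalCell φ.A φ.B n} (hc : c ∈ φ.cells n)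
    (y : sphere (0 : Fin n → ℝ) 1) : c.attach y ∈ formalSkeletonLT φ.skel φ.cells n :=
  (mem_cells_iff'.1 hc).2.2.1 y

lemma attach_mem_stage {n : ℕ} {c : FormalCell φ.A φ.B n} (hc : c ∈ φ.cells n)
    (y : sphere (0 : Fin n → ℝ) 1) : c.attach y ∈ φ.stage n :=
  formalSkeletonLT_subset_stage n (attach_mem_formalSkeletonLT hc y)

lemma point_mem_stage_iff {n k : ℕ} {c : FormalCell φ.A φ.B n} (x : ball (0 : Fin n → ℝ) 1) :
    c.point x ∈ φ.stage k ↔ n < k ∧ c ∈ φ.cells n := Iff.rfl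

lemma base_mem_stage {k : ℕ} (a : φ.A) : .base a ∈ φ.stage k := trivial

lemma charMap_mem_formalSkeletonLT {n k : ℕ} {c : FormalCell φ.A φ.B n} (hc : c ∈ φ.cells n)
    (h : n < k) (x : Fin n → ℝ) : c.charMap x ∈ formalSkeletonLT φ.skel φ.cells k := by
  unfold FormalCell.charMap
  split_ifs with h1 h2
  · exact formalSkeletonLT_mono (fun _ _ h => skel_mono h) h.le (attach_mem_formalSkeletonLT hc _)
  · exact ⟨h, hc⟩
  · exact ⟨h, hc⟩

lemma charMap_mem_stage {n k : ℕ} {c : FormalCell φ.A φ.B n} (hc : c ∈ φ.cells n)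
    (h : n < k) (x : Fin n → ℝ) : c.charMap x ∈ φ.stage k :=
  formalSkeletonLT_subset_stage k (charMap_mem_formalSkeletonLT hc h x)

lemma charMap_mem_points {n : ℕ} {c : FormalCell φ.A φ.B n} (hc : c ∈ φ.cells n)
    (x : Fin n → ℝ) : c.charMap x ∈ φ.points :=
  stage_subset_points _ (charMap_mem_stage hc n.lt_succ_self x)

lemma isClosedEmbedding_sphere_inclusion (n : ℕ) :
    IsClosedEmbedding (inclusion (sphere_subset_closedBall (x := (0 : Fin n → ℝ)) (ε := 1))) := by
  refine ⟨IsEmbedding.inclusion _, ?_⟩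
  rw [range_inclusion]
  exact isClosed_sphere.preimage continuous_subtype_val

lemma eq_sphere_or_ball {n : ℕ} (x : closedBall (0 : Fin n → ℝ) 1) :
    (∃ y : sphere (0 : Fin n → ℝ) 1, x = inclusion sphere_subset_closedBall y) ∨
      ∃ y : ball (0 : Fin n → ℝ) 1, x = inclusion ball_subset_closedBall y := by
  rcases (mem_closedBall_zero_iff.1 x.2).lt_or_eq with h | h
  · exact .inr ⟨⟨x, by simpa using h⟩, rfl⟩
  · exact .inl ⟨⟨x, by simpa using h⟩, rfl⟩

/-- A set of formal points which misses the interior of a cell of `φ` pulls back to a closed subset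
of the disk if it pulls back to a closed subset of the sphere. -/
lemma isClosed_charMap_preimage_of_sphere {n : ℕ} {c : FormalCell φ.A φ.B n}
    {Z : Set (FormalPoint φ.A φ.B)} (hZ : ∀ x, c.point x ∉ Z) (h : IsClosed (c.attach ⁻¹' Z)) :
    IsClosed {x : closedBall (0 : Fin n → ℝ) 1 | c.charMap x ∈ Z} := by
  convert! (isClosedEmbedding_sphere_inclusion n).isClosedMap _ h
  ext x
  simp only [mem_ofPred_eq, mem_image, mem_preimage]
  constructor
  · intro hx
    obtain ⟨y, rfl⟩ | ⟨y, rfl⟩ := eq_sphere_or_ball x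
    · exact ⟨y, by simpa [c.charMap_sphere] using hx, rfl⟩
    · exact absurd (by simpa [c.charMap_ball] using hx) (hZ y)
  · rintro ⟨y, hy, rfl⟩
    simpa [c.charMap_sphere] using hy

/-- A cell of dimension at least `k` has its interior outside the stage, so only its boundary
matters. There the attaching function is continuous for the topology of the cells of dimension below
`m`, to which the induction hypothesis applies. -/
lemma isClosed_charMap_preimage_inter_stage {k : ℕ} {Z : Set (FormalPoint φ.A φ.B)}
    (hZ : IsClosed[cellsTopology (φ.cellsLT k)] Z) (m : ℕ) (c : FormalCell φ.A φ.B m)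
    (hc : c ∈ φ.cells m) :
    IsClosed {x : closedBall (0 : Fin m → ℝ) 1 | c.charMap x ∈ Z ∩ φ.stage k} := by
  induction m using Nat.strong_induction_on with
  | _ m ih =>
    rw [isClosed_cellsTopology_iff] at hZ
    by_cases hm : m < k
    · simpa [charMap_mem_stage hc hm] using hZ.2 m c ⟨hm, hc⟩
    · refine isClosed_charMap_preimage_of_sphere (fun x hx => hm hx.2.1) ?_
      refine @IsClosed.preimage _ _ _ (cellsTopology (φ.cellsLT m)) _
        (mem_cells_iff'.1 hc).1 _ ?_
      rw [isClosed_cellsTopology_iff]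
      refine ⟨?_, fun n c hc => ih n hc.1 c hc.2⟩
      convert hZ.1 using 1
      ext a
      simp [base_mem_stage]

/-- Together with `cellsTopology_mono` this shows that the cells of dimension less than `k` and all
cells induce the same topology on the stage, and that the stage is closed. -/
lemma isClosed_inter_stage {k : ℕ} {Z : Set (FormalPoint φ.A φ.B)}
    (hZ : IsClosed[cellsTopology (φ.cellsLT k)] Z) :
    IsClosed[cellsTopology φ.cells] (Z ∩ φ.stage k) := by
  refine isClosed_cellsTopology_iff.2 ⟨?_, isClosed_charMap_preimage_inter_stage hZ⟩
  convert (isClosed_cellsTopology_iff.1 hZ).1 using 1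
  ext a
  simp [base_mem_stage]

lemma cellsLT_subset (k n : ℕ) : φ.cellsLT k n ⊆ φ.cells n := fun _ h => h.2

lemma continuous_attach_iff {k : ℕ} {T : Type*} [TopologicalSpace T]
    {α : T → FormalPoint φ.A φ.B} (hα : ∀ y, α y ∈ φ.stage k) :
    Continuous[inferInstance, cellsTopology (φ.cellsLT k)] α ↔
      Continuous[inferInstance, cellsTopology φ.cells] α := by
  refine ⟨fun h => continuous_le_rng (cellsTopology_mono (cellsLT_subset k)) h, fun h => ?_⟩
  refine (@continuous_iff_isClosed _ _ _ (cellsTopology (φ.cellsLT k)) _).2 fun Z hZ => ?_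
  convert @IsClosed.preimage _ _ _ (cellsTopology φ.cells) _ h _ (isClosed_inter_stage hZ) using 1
  ext y
  simp [hα]

/-- Frees the membership criterion from the recursion: continuity is tested in a single topology for
all dimensions. -/
lemma mem_cells_iff {n : ℕ} {c : FormalCell φ.A φ.B n} :
    c ∈ φ.cells n ↔ Continuous[inferInstance, cellsTopology φ.cells] c.attach ∧
      Continuous c.disk ∧ (∀ y, c.attach y ∈ formalSkeletonLT φ.skel φ.cells n) ∧
      ∀ y, (c.attach y).proj φ.f = c.disk ⟨y, sphere_subset_closedBall y.2⟩ := by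
  rw [mem_cells_iff']
  constructor
  · rintro ⟨h1, h2, h3, h4⟩
    exact ⟨(continuous_attach_iff fun y => formalSkeletonLT_subset_stage n (h3 y)).1 h1, h2, h3, h4⟩
  · rintro ⟨h1, h2, h3, h4⟩
    exact ⟨(continuous_attach_iff fun y => formalSkeletonLT_subset_stage n (h3 y)).2 h1, h2, h3, h4⟩

end MapFromCW

/-- The total space of the factorization of `φ`. -/
def Total (φ : MapFromCW.{u}) : Type u := {P // P ∈ φ.points}

namespace Total

open MapFromCW

variable {φ ψ χ : MapFromCW.{u}}

noncomputable instance : TopologicalSpace (Total φ) := .induced Subtype.val (cellsTopology φ.cells)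

/-- The inclusion of `A`. -/
def incl (φ : MapFromCW.{u}) (a : φ.A) : Total φ := ⟨.base a, trivial⟩

/-- The characteristic maps of the new cells. -/
noncomputable def charMap {n : ℕ} (c : φ.cells n) (x : Fin n → ℝ) : Total φ :=
  ⟨c.1.charMap x, charMap_mem_points c.2 x⟩

/-- The map to `B`. -/
def proj (φ : MapFromCW.{u}) (P : Total φ) : φ.B := P.1.proj φ.f

/-- `A` and the characteristic functions of the cells of `φ` only take values in `φ.points`, so
passing from `Total φ` to all formal points changes none of the tested preimages. Hence the induced
topology on `Total φ` is again a final topology, as `isClosed_iff` and `continuous_iff` record. -/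
lemma isClosed_image_val {Z : Set (Total φ)} (h₀ : IsClosed (incl φ ⁻¹' Z))
    (h : ∀ n (c : φ.cells n), IsClosed {x : closedBall (0 : Fin n → ℝ) 1 | charMap c x ∈ Z}) :
    IsClosed[cellsTopology φ.cells] (Subtype.val '' Z) := by
  rw [isClosed_cellsTopology_iff]
  constructor
  · convert h₀
    ext a
    exact ⟨fun ⟨P, hP, h⟩ => by rwa [mem_preimage, show incl φ a = P from Subtype.ext h.symm],
      fun h => ⟨_, h, rfl⟩⟩
  · intro n c hc
    convert h n ⟨c, hc⟩ using 1
    ext a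
    exact ⟨fun ⟨P, hP, h⟩ => by
      rwa [mem_ofPred_eq, show charMap ⟨c, hc⟩ a = P from Subtype.ext h.symm],
      fun h => ⟨_, h, rfl⟩⟩

lemma isClosed_iff {Z : Set (Total φ)} : IsClosed Z ↔ IsClosed (incl φ ⁻¹' Z) ∧
    ∀ n (c : φ.cells n), IsClosed {x : closedBall (0 : Fin n → ℝ) 1 | charMap c x ∈ Z} := by
  constructor
  · rintro h
    obtain ⟨W, hW, rfl⟩ := (@isClosed_induced_iff _ _ (cellsTopology φ.cells) Z Subtype.val).1 h
    obtain ⟨h1, h2⟩ := isClosed_cellsTopology_iff.1 hW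
    exact ⟨h1, fun n c => h2 n c.1 c.2⟩
  · rintro ⟨h1, h2⟩
    exact (@isClosed_induced_iff _ _ (cellsTopology φ.cells) Z Subtype.val).2 ⟨_, isClosed_image_val h1 h2,
      preimage_image_eq _ Subtype.val_injective⟩

lemma continuous_iff {Y : Type*} [TopologicalSpace Y] {g : Total φ → Y} :
    Continuous g ↔ Continuous (g ∘ incl φ) ∧ ∀ n (c : φ.cells n),
      Continuous fun x : closedBall (0 : Fin n → ℝ) 1 => g (charMap c x) := by
  simp only [continuous_iff_isClosed, isClosed_iff]
  exact ⟨fun h => ⟨fun s hs => (h s hs).1, fun n c s hs => (h s hs).2 n c⟩,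
    fun h s hs => ⟨h.1 s hs, fun n c => h.2 n c s hs⟩⟩

lemma continuous_incl (φ : MapFromCW.{u}) : Continuous (incl φ) :=
  (continuous_iff.1 continuous_id).1

lemma continuous_charMap {n : ℕ} (c : φ.cells n) :
    Continuous fun x : closedBall (0 : Fin n → ℝ) 1 => charMap c x :=
  (continuous_iff.1 continuous_id).2 n c

lemma proj_charMap {n : ℕ} (c : φ.cells n) (x : closedBall (0 : Fin n → ℝ) 1) :
    proj φ (charMap c x) = c.1.disk x := by
  obtain ⟨y, rfl⟩ | ⟨y, rfl⟩ := eq_sphere_or_ball x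
  · simp only [proj, charMap, c.1.charMap_sphere]
    exact (mem_cells_iff.1 c.2).2.2.2 y
  · simp only [proj, charMap, c.1.charMap_ball]
    rfl

lemma continuous_proj (φ : MapFromCW.{u}) : Continuous (proj φ) := by
  refine continuous_iff.2 ⟨φ.f.continuous, fun n c => ?_⟩
  simp only [proj_charMap]
  exact (mem_cells_iff.1 c.2).2.1

end Total

/-- The map of formal points induced by maps `h : A → A'` and `g : B → B'`. -/
def FormalPoint.map {A A' B B' : Type u} (h : A → A') (g : B → B') :
    FormalPoint A B → FormalPoint A' B'
  | .base a => .base (h a)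
  | .cell n α β x => .cell n (fun y => FormalPoint.map h g (α y)) (g ∘ β) x

/-- The map of formal cells induced by maps `h : A → A'` and `g : B → B'`. -/
def FormalCell.map {A A' B B' : Type u} (h : A → A') (g : B → B') {n : ℕ} (c : FormalCell A B n) :
    FormalCell A' B' n where
  attach := FormalPoint.map h g ∘ c.attach
  disk := g ∘ c.disk

lemma FormalCell.charMap_map {A A' B B' : Type u} (h : A → A') (g : B → B') {n : ℕ}
    (c : FormalCell A B n) (x : Fin n → ℝ) :
    (c.map h g).charMap x = (c.charMap x).map h g := by
  unfold FormalCell.charMap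
  split_ifs <;> rfl

lemma FormalPoint.map_id {A B : Type u} (P : FormalPoint A B) : P.map id id = P := by
  induction P with
  | base a => rfl
  | cell n α β x ih => simp [FormalPoint.map, ih]

lemma FormalPoint.map_map {A A' A'' B B' B'' : Type u} (h : A → A') (g : B → B') (h' : A' → A'')
    (g' : B' → B'') (P : FormalPoint A B) : (P.map h g).map h' g' = P.map (h' ∘ h) (g' ∘ g) := by
  induction P with
  | base a => rfl
  | cell n α β x ih => simp [FormalPoint.map, ih, Function.comp_assoc]

lemma FormalPoint.proj_map {A A' B B' : Type u} {h : A → A'} {g : B → B'} {f : A → B}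
    {f' : A' → B'} (H : ∀ a, f' (h a) = g (f a)) (P : FormalPoint A B) :
    (P.map h g).proj f' = g (P.proj f) := by
  cases P with
  | base a => exact H a
  | cell n α β x => rfl

namespace MapFromCW

variable {φ ψ : MapFromCW.{u}}

lemma Hom.mapsTo_skel (σ : φ ⟶ ψ) (n : ℕ) : MapsTo σ.top (φ.skel n) (ψ.skel n) := by
  cases n with
  | zero =>
    intro a ha
    have h0 : φ.skel 0 = ∅ := by
      rw [skel]
      exact_mod_cast CWComplex.skeletonLT_zero_eq_empty (C := (univ : Set φ.A))
    simp [h0] at ha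
  | succ n => exact_mod_cast σ.cellular n

lemma Hom.comm_apply (σ : φ ⟶ ψ) (a : φ.A) : ψ.f (σ.top a) = σ.bot (φ.f a) :=
  DFunLike.congr_fun σ.comm a

/-- Substitution carries characteristic functions to characteristic functions. By induction on
dimension it is therefore continuous on the lower cells, which gives continuity of the new attaching
function. Cellularity of `σ.top` keeps the attaching values in the skeleton. -/
lemma map_mem_cells (σ : φ ⟶ ψ) {n : ℕ} {c : FormalCell φ.A φ.B n} (hc : c ∈ φ.cells n) :
    c.map σ.top σ.bot ∈ ψ.cells n := by
  induction n using Nat.strong_induction_on with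
  | _ n ih =>
    obtain ⟨h1, h2, h3, h4⟩ := mem_cells_iff'.1 hc
    refine mem_cells_iff'.2 ⟨?_, σ.bot.continuous.comp h2, fun y => ?_, fun y => ?_⟩
    · refine (@continuous_iff_isClosed _ _ _ (cellsTopology (ψ.cellsLT n)) _).2 fun Z hZ => ?_
      refine @IsClosed.preimage _ _ _ (cellsTopology (φ.cellsLT n)) _ h1
        (FormalPoint.map σ.top σ.bot ⁻¹' Z) ?_
      rw [isClosed_cellsTopology_iff] at hZ ⊢
      refine ⟨hZ.1.preimage σ.top.continuous, fun m d hd => ?_⟩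
      simpa only [FormalCell.charMap_map, mem_preimage] using hZ.2 m _ ⟨hd.1, ih m hd.1 hd.2⟩
    · have := h3 y
      change (c.attach y).map σ.top σ.bot ∈ _
      generalize c.attach y = P at this
      obtain (a | ⟨m, α, β, x⟩) := P
      · exact σ.mapsTo_skel n this
      · exact ⟨this.1, ih m this.1 this.2⟩
    · exact (FormalPoint.proj_map σ.comm_apply _).trans congr(σ.bot $(h4 y))

lemma map_mem_points (σ : φ ⟶ ψ) {P : FormalPoint φ.A φ.B} (hP : P ∈ φ.points) :
    P.map σ.top σ.bot ∈ ψ.points := by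
  obtain (a | ⟨m, α, β, x⟩) := P
  · trivial
  · exact map_mem_cells σ hP

end MapFromCW

namespace Total

open MapFromCW

variable {φ ψ : MapFromCW.{u}}

/-- The map of total spaces induced by a commutative square. -/
def map (σ : φ ⟶ ψ) : C(Total φ, Total ψ) where
  toFun P := ⟨P.1.map σ.top σ.bot, map_mem_points σ P.2⟩
  continuous_toFun := by
    refine continuous_iff.2 ⟨(continuous_incl ψ).comp σ.top.continuous, fun n c => ?_⟩
    exact (continuous_charMap ⟨_, map_mem_cells σ c.2⟩).congr fun x =>
      Subtype.ext (FormalCell.charMap_map _ _ _ _)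

/-- The functor taking a map `f : A → B` from a CW complex to its total space. -/
noncomputable def functor : MapFromCW.{u} ⥤ TopCat.{u} where
  obj φ := TopCat.of (Total φ)
  map σ := TopCat.ofHom (map σ)
  map_id φ := by
    ext P
    exact Subtype.ext P.1.map_id
  map_comp σ τ := by
    ext P
    exact Subtype.ext (P.1.map_map σ.top σ.bot τ.top τ.bot).symm

/-- The inclusions of the CW complexes into the total spaces. -/
noncomputable def inclusion : domFunctor.{u} ⟶ functor.{u} where
  app φ := TopCat.ofHom ⟨incl φ, continuous_incl φ⟩

/-- The maps from the total spaces to the codomains. -/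
noncomputable def projection : functor.{u} ⟶ codFunctor.{u} where
  app φ := TopCat.ofHom ⟨proj φ, continuous_proj φ⟩
  naturality φ ψ σ := by
    ext P
    exact FormalPoint.proj_map σ.comm_apply P.1

lemma inclusion_comp_projection : inclusion.{u} ≫ projection.{u} = tautological.{u} := rfl

end Total

end CellularFactorization

/-! ### The total space is Hausdorff -/

namespace CellularFactorization

open Metric Set

/-- The radial projection of a vector outside of the ball of radius `1 / 2` to the unit sphere. -/
noncomputable def direction {n : ℕ} (x : Fin n → ℝ) (h : 1 / 2 < ‖x‖) :
    sphere (0 : Fin n → ℝ) 1 :=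
  ⟨‖x‖⁻¹ • x, by
    have : 0 < ‖x‖ := by linarith
    simp [norm_smul, this.ne']⟩

lemma direction_sphere {n : ℕ} (x : sphere (0 : Fin n → ℝ) 1) (h : 1 / 2 < ‖(x : Fin n → ℝ)‖) :
    direction (x : Fin n → ℝ) h = x := by
  ext1
  simp [direction]

lemma continuous_direction (n : ℕ) :
    Continuous fun x : {x : closedBall (0 : Fin n → ℝ) 1 // 1 / 2 < ‖(x : Fin n → ℝ)‖} =>
      direction (x : Fin n → ℝ) x.2 := by
  have h : Continuous fun x : {x : closedBall (0 : Fin n → ℝ) 1 // 1 / 2 < ‖(x : Fin n → ℝ)‖} =>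
      (x : Fin n → ℝ) := by fun_prop
  exact ((h.norm.inv₀ fun x => by linarith [x.2]).smul h).subtype_mk _

/-- The extension of a set of points of cells of dimension less than `k` along collars of the
boundaries of the cells of dimension at least `k`. -/
def collar {A B : Type u} (k : ℕ) (U : Set (FormalPoint A B)) : FormalPoint A B → Prop
  | .base a => .base a ∈ U
  | .cell n α β x => (n < k ∧ .cell n α β x ∈ U) ∨
      (k ≤ n ∧ ∃ h : 1 / 2 < ‖(x : Fin n → ℝ)‖, collar k U (α (direction (x : Fin n → ℝ) h)))

namespace MapFromCW

variable {φ : MapFromCW.{u}} {k : ℕ} {U V : Set (FormalPoint φ.A φ.B)}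

lemma collar_iff_of_mem_stage {P : FormalPoint φ.A φ.B} (hP : P ∈ φ.stage k) :
    collar k U P ↔ P ∈ U := by
  obtain (a | ⟨m, α, β, x⟩) := P
  · rfl
  · simp [collar, hP.1, hP.1.not_ge]

lemma not_collar_of_disjoint (h : Disjoint U V) (P : FormalPoint φ.A φ.B) :
    ¬ (collar k U P ∧ collar k V P) := by
  induction P with
  | base a => exact fun H => disjoint_left.1 h H.1 H.2
  | cell n α β x ih =>
    rintro ⟨⟨h1, h1'⟩ | ⟨h1, h1', h1''⟩, ⟨h2, h2'⟩ | ⟨h2, h2', h2''⟩⟩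
    · exact disjoint_left.1 h h1' h2'
    · omega
    · omega
    · exact ih _ ⟨h1'', h2''⟩

/-- On a cell of dimension at least `k` the collar is the radial pullback, to the part of norm
greater than 1/2, of its own trace on the boundary sphere. That trace is open by induction on the
dimension. -/
lemma isOpen_collar_preimage (hU : IsOpen[cellsTopology (φ.cellsLT k)] U) (m : ℕ)
    (c : FormalCell φ.A φ.B m) (hc : c ∈ φ.cells m) :
    IsOpen {x : closedBall (0 : Fin m → ℝ) 1 | collar k U (c.charMap x)} := by
  induction m using Nat.strong_induction_on with
  | _ m ih =>
    rw [isOpen_cellsTopology_iff] at hU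
    by_cases hm : m < k
    · simpa [collar_iff_of_mem_stage (charMap_mem_stage hc hm _)] using hU.2 m c ⟨hm, hc⟩
    have h1 : IsOpen (c.attach ⁻¹' {P | collar k U P}) := by
      refine @IsOpen.preimage _ _ _ (cellsTopology (φ.cellsLT m)) _ (mem_cells_iff'.1 hc).1 _ ?_
      rw [isOpen_cellsTopology_iff]
      exact ⟨hU.1, fun n c hc => ih n hc.1 c hc.2⟩
    have h2 : IsOpen {x : closedBall (0 : Fin m → ℝ) 1 | 1 / 2 < ‖(x : Fin m → ℝ)‖} :=
      isOpen_lt continuous_const (by fun_prop)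
    convert h2.isOpenMap_subtype_val _ (h1.preimage (continuous_direction m)) using 1
    ext x
    simp only [mem_ofPred_eq, mem_image, mem_preimage, Subtype.exists, exists_and_right,
      exists_eq_right]
    obtain ⟨y, rfl⟩ | ⟨y, rfl⟩ := eq_sphere_or_ball x
    · simp only [direction_sphere, c.charMap_sphere]
      refine ⟨fun h => ⟨?_, h⟩, fun ⟨_, h⟩ => h⟩
      norm_num [y.2]
    · simp only [c.charMap_ball]
      change _ ∨ _ ↔ _
      simp only [hm, false_and, false_or, not_lt.1 hm, true_and]

lemma attach_ne_point {n m : ℕ} {c : FormalCell φ.A φ.B n} {d : FormalCell φ.A φ.B m} (h : m ≤ n)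
    (hd : d ∈ φ.cells m) (y : sphere (0 : Fin m → ℝ) 1) (x : ball (0 : Fin n → ℝ) 1) :
    d.attach y ≠ c.point x := by
  intro H
  have := stage_mono h (attach_mem_stage hd y)
  rw [H] at this
  exact this.1.false

lemma charMap_preimage_eq_empty {n m : ℕ} {c : FormalCell φ.A φ.B n} {d : FormalCell φ.A φ.B m}
    (h : m < n) (hd : d ∈ φ.cells m) (W : Set (ball (0 : Fin n → ℝ) 1)) :
    {x : closedBall (0 : Fin m → ℝ) 1 | d.charMap x ∈ c.point '' W} = ∅ := by
  refine eq_empty_of_forall_notMem fun x ⟨y, _, hy⟩ => ?_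
  have := charMap_mem_stage hd h x
  rw [← hy] at this
  exact this.1.false

lemma charMap_preimage_eq_empty_of_ne {n : ℕ} {c d : FormalCell φ.A φ.B n}
    (h : d ≠ c) (hd : d ∈ φ.cells n) (W : Set (ball (0 : Fin n → ℝ) 1)) :
    {x : closedBall (0 : Fin n → ℝ) 1 | d.charMap x ∈ c.point '' W} = ∅ := by
  refine eq_empty_of_forall_notMem fun x ⟨y, _, hy⟩ => ?_
  obtain ⟨z, rfl⟩ | ⟨z, rfl⟩ := eq_sphere_or_ball x
  · rw [coe_inclusion, d.charMap_sphere] at hy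
    exact attach_ne_point le_rfl hd z y hy.symm
  · rw [coe_inclusion, d.charMap_ball] at hy
    injection hy with h1 h2 h3
    exact h (FormalCell.ext h2.symm h3.symm)

lemma charMap_preimage_point_image {n : ℕ} {c : FormalCell φ.A φ.B n} (hc : c ∈ φ.cells n)
    (W : Set (ball (0 : Fin n → ℝ) 1)) :
    {x : closedBall (0 : Fin n → ℝ) 1 | c.charMap x ∈ c.point '' W} =
      inclusion ball_subset_closedBall '' W := by
  ext x
  simp only [mem_ofPred_eq, mem_image]
  obtain ⟨z, rfl⟩ | ⟨z, rfl⟩ := eq_sphere_or_ball x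
  · simp only [c.charMap_sphere]
    constructor
    · rintro ⟨y, _, hy⟩
      exact absurd hy.symm (attach_ne_point le_rfl hc z y)
    · rintro ⟨y, _, hy⟩
      have h1 := y.2
      have h2 := z.2
      have h3 : (y : Fin n → ℝ) = z := congrArg Subtype.val hy
      rw [h3, mem_ball_zero_iff] at h1
      rw [mem_sphere_zero_iff_norm] at h2
      linarith
  · simp only [c.charMap_ball, c.point_injective.eq_iff,
      (inclusion_injective _).eq_iff]

/-- Openness is only claimed among cells of dimension at most `n`: higher cells may be attached to
this one. Collars later extend such sets to open sets of the whole space. -/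
lemma isOpen_point_image {n : ℕ} {c : FormalCell φ.A φ.B n} (hc : c ∈ φ.cells n)
    {W : Set (ball (0 : Fin n → ℝ) 1)} (hW : IsOpen W) :
    IsOpen[cellsTopology (φ.cellsLT (n + 1))] (c.point '' W) := by
  rw [isOpen_cellsTopology_iff]
  constructor
  · convert isOpen_empty
    exact eq_empty_of_forall_notMem fun a ⟨y, _, hy⟩ => by cases hy
  · rintro m d ⟨hm, hd⟩
    obtain hm | rfl := (Nat.le_of_lt_succ hm).lt_or_eq
    · rw [charMap_preimage_eq_empty hm hd]
      exact isOpen_empty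
    by_cases h : d = c
    · rw [h, charMap_preimage_point_image hc]
      refine IsOpenEmbedding.isOpenMap ⟨IsEmbedding.inclusion _, ?_⟩ _ hW
      rw [range_inclusion]
      exact isOpen_ball.preimage continuous_subtype_val
    · rw [charMap_preimage_eq_empty_of_ne h hd]
      exact isOpen_empty

lemma isClosed_point_image {n : ℕ} {c : FormalCell φ.A φ.B n} (hc : c ∈ φ.cells n)
    {r : ℝ} (hr : r < 1) :
    IsClosed[cellsTopology (φ.cellsLT (n + 1))] (c.point '' {x | ‖(x : Fin n → ℝ)‖ ≤ r}) := by
  rw [isClosed_cellsTopology_iff]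
  constructor
  · convert isClosed_empty
    exact eq_empty_of_forall_notMem fun a ⟨y, _, hy⟩ => by cases hy
  · rintro m d ⟨hm, hd⟩
    obtain hm | rfl := (Nat.le_of_lt_succ hm).lt_or_eq
    · rw [charMap_preimage_eq_empty hm hd]
      exact isClosed_empty
    by_cases h : d = c
    · rw [h, charMap_preimage_point_image hc]
      have : IsClosed {x : closedBall (0 : Fin m → ℝ) 1 | ‖(x : Fin m → ℝ)‖ ≤ r} :=
        isClosed_le (by fun_prop) continuous_const
      convert this
      ext x
      exact ⟨fun ⟨y, hy, h⟩ => h ▸ hy, fun hx => ⟨⟨x, by simpa using lt_of_le_of_lt hx hr⟩, hx, rfl⟩⟩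
    · rw [charMap_preimage_eq_empty_of_ne h hd]
      exact isClosed_empty

/-- Two points can be separated by open sets in some stage. -/
def StageSeparated (P Q : FormalPoint φ.A φ.B) : Prop :=
  ∃ k, P ∈ φ.stage k ∧ Q ∈ φ.stage k ∧ ∃ U V, IsOpen[cellsTopology (φ.cellsLT k)] U ∧
    IsOpen[cellsTopology (φ.cellsLT k)] V ∧ P ∈ U ∧ Q ∈ V ∧ Disjoint U V

lemma StageSeparated.symm {P Q : FormalPoint φ.A φ.B} (h : StageSeparated P Q) :
    StageSeparated Q P := by
  obtain ⟨k, h1, h2, U, V, hU, hV, hP, hQ, hUV⟩ := h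
  exact ⟨k, h2, h1, V, U, hV, hU, hQ, hP, hUV.symm⟩

lemma stageSeparated_point {n : ℕ} {c : FormalCell φ.A φ.B n} (hc : c ∈ φ.cells n)
    {P : FormalPoint φ.A φ.B} (hP : P ∈ φ.stage (n + 1)) (x : ball (0 : Fin n → ℝ) 1)
    (h : P ≠ c.point x) : StageSeparated P (c.point x) := by
  refine ⟨n + 1, hP, ⟨n.lt_succ_self, hc⟩, ?_⟩
  by_cases h' : ∃ y, P = c.point y
  · obtain ⟨y, rfl⟩ := h'
    obtain ⟨U, V, hU, hV, hy, hx, hUV⟩ := t2_separation (ne_of_apply_ne _ h)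
    exact ⟨_, _, isOpen_point_image hc hU, isOpen_point_image hc hV, ⟨y, hy, rfl⟩, ⟨x, hx, rfl⟩,
      (disjoint_image_iff c.point_injective).2 hUV⟩
  -- A point outside the open cell is separated from `c.point x` by a sphere of radius `r` between
  -- `‖x‖` and 1: the smaller open ball against the complement of the closed one.
  · obtain ⟨r, hr, hr'⟩ := exists_between (mem_ball_zero_iff.1 x.2)
    refine ⟨_, c.point '' {x | ‖(x : Fin n → ℝ)‖ < r},
      (@isOpen_compl_iff _ _ (cellsTopology (φ.cellsLT (n + 1)))).2 (isClosed_point_image hc hr'),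
      isOpen_point_image hc (isOpen_lt (by fun_prop) continuous_const),
      fun ⟨y, _, hy⟩ => h' ⟨y, hy.symm⟩, ⟨x, hr, rfl⟩, ?_⟩
    exact disjoint_compl_left_iff_subset.2 (image_mono fun y (hy : _ < r) => hy.le)

lemma stageSeparated {P Q : FormalPoint φ.A φ.B} (hP : P ∈ φ.points) (hQ : Q ∈ φ.points)
    (h : P ≠ Q) : StageSeparated P Q := by
  obtain (a | ⟨m, α, β, x⟩) := P <;> obtain (b | ⟨n, α', β', y⟩) := Q
  · obtain ⟨U, V, hU, hV, hy, hx, hUV⟩ := t2_separation (ne_of_apply_ne _ h)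
    have hi : Function.Injective (FormalPoint.base (A := φ.A) (B := φ.B)) := fun a b h => by
      injection h
    have key {U : Set φ.A} (hU : IsOpen U) :
        IsOpen[cellsTopology (φ.cellsLT 0)] (FormalPoint.base '' U) := by
      rw [isOpen_cellsTopology_iff, preimage_image_eq _ hi]
      exact ⟨hU, fun n c hc => absurd hc.1 n.not_lt_zero⟩
    exact ⟨0, trivial, trivial, _, _, key hU, key hV, ⟨a, hy, rfl⟩, ⟨b, hx, rfl⟩,
      (disjoint_image_iff hi).2 hUV⟩
  · exact stageSeparated_point (c := ⟨α', β'⟩) hQ (base_mem_stage a) y h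
  · exact (stageSeparated_point (c := ⟨α, β⟩) hP (base_mem_stage b) x h.symm).symm
  · obtain hmn | hmn := le_total m n
    · exact stageSeparated_point (c := ⟨α', β'⟩) hQ
        ((point_mem_stage_iff (c := ⟨α, β⟩) x).2 ⟨Nat.lt_succ_of_le hmn, hP⟩) y h
    · exact (stageSeparated_point (c := ⟨α, β⟩) hP
        ((point_mem_stage_iff (c := ⟨α', β'⟩) y).2 ⟨Nat.lt_succ_of_le hmn, hQ⟩) x h.symm).symm

end MapFromCW

namespace Total

open MapFromCW

variable {φ : MapFromCW.{u}}

instance : T2Space (Total φ) where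
  t2 P Q h := by
    obtain ⟨k, hP, hQ, U, V, hU, hV, hPU, hQV, hUV⟩ :=
      stageSeparated P.2 Q.2 (Subtype.val_injective.ne h)
    have key {U : Set (FormalPoint φ.A φ.B)} (hU : IsOpen[cellsTopology (φ.cellsLT k)] U) :
        IsOpen {P : Total φ | collar k U P.1} := by
      refine (@isOpen_induced_iff _ _ (cellsTopology φ.cells) _ Subtype.val).2
        ⟨{P | collar k U P}, ?_, rfl⟩
      rw [isOpen_cellsTopology_iff]
      exact ⟨(isOpen_cellsTopology_iff.1 hU).1, isOpen_collar_preimage hU⟩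
    exact ⟨_, _, key hU, key hV, (collar_iff_of_mem_stage hP).2 hPU,
      (collar_iff_of_mem_stage hQ).2 hQV,
      disjoint_left.2 fun P h1 h2 => not_collar_of_disjoint hUV P.1 ⟨h1, h2⟩⟩

lemma incl_injective (φ : MapFromCW.{u}) : Function.Injective (incl φ) := fun a b h => by
  injection h with h
  injection h

/-- This is `isClosed_inter_stage` for `k = 0`, where no cells are present and the stage is `A`
itself. -/
lemma isClosedEmbedding_incl (φ : MapFromCW.{u}) : IsClosedEmbedding (incl φ) := by
  refine .of_continuous_injective_isClosedMap (continuous_incl φ) (incl_injective φ) fun Z hZ => ?_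
  have h0 : IsClosed[cellsTopology (φ.cellsLT 0)] (FormalPoint.base '' Z) := by
    rw [isClosed_cellsTopology_iff, preimage_image_eq _ (fun a b h => by injection h)]
    exact ⟨hZ, fun n c hc => absurd hc.1 n.not_lt_zero⟩
  refine (@isClosed_induced_iff _ _ (cellsTopology φ.cells) _ Subtype.val).2
    ⟨_, isClosed_inter_stage h0, ?_⟩
  ext P
  constructor
  · rintro ⟨⟨a, ha, h⟩, -⟩
    exact ⟨a, ha, Subtype.ext h⟩
  · rintro ⟨a, ha, rfl⟩
    exact ⟨⟨a, ha, rfl⟩, trivial⟩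

end Total

end CellularFactorization

/-! ### Compactness and finiteness of the cells met -/

namespace CellularFactorization

open Metric Set

/-- A subset of a compact set all of whose subsets are closed is finite. -/
lemma finite_of_forall_subset_isClosed {Y : Type*} [TopologicalSpace Y] {K T : Set Y}
    (hK : IsCompact K) (hT : T ⊆ K) (h : ∀ T' ⊆ T, IsClosed T') : T.Finite := by
  have hd : DiscreteTopology T := by
    refine discreteTopology_iff_forall_isClosed.2 fun s => ?_
    convert (h (Subtype.val '' s) (by simp)).preimage continuous_subtype_val
    rw [preimage_image_eq _ Subtype.val_injective]
  exact (hK.of_isClosed_subset (h T le_rfl) hT).finite (isDiscrete_iff_discreteTopology.2 hd)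

/-- A compact subset of a CW complex meets only finitely many open cells. -/
lemma finite_setOf_openCell_inter_nonempty {X : Type*} [TopologicalSpace X] [T2Space X]
    [CWComplex (univ : Set X)] {K : Set X} (hK : IsCompact K) :
    {p : Σ n, RelCWComplex.cell (univ : Set X) n |
      (K ∩ RelCWComplex.openCell p.1 p.2).Nonempty}.Finite := by
  set F := {p : Σ n, RelCWComplex.cell (univ : Set X) n |
      (K ∩ RelCWComplex.openCell p.1 p.2).Nonempty}
  choose x hx using fun p : F => p.2
  have inj (p : F) {q : Σ n, RelCWComplex.cell (univ : Set X) n}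
      (h : x p ∈ RelCWComplex.openCell q.1 q.2) : p.1 = q := by
    obtain ⟨⟨n, i⟩, hp⟩ := p
    obtain ⟨m, j⟩ := q
    by_contra hne
    exact disjoint_left.1 (RelCWComplex.disjoint_openCell_of_ne hne) (hx ⟨⟨n, i⟩, hp⟩).2 h
  -- One point is chosen in every open cell that is met. Any subset of these points is closed, since
  -- a closed cell lies in finitely many open cells and each of them contains at most one chosen
  -- point.
  have hfin : (range x).Finite := by
    refine finite_of_forall_subset_isClosed hK (range_subset_iff.2 fun p => (hx p).1)
      fun T hT => ?_
    refine (CWComplex.closed (univ : Set X) T (subset_univ _)).2 fun n i => Finite.isClosed ?_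
    obtain ⟨I, hI⟩ := CWComplex.cellFrontier_subset_finite_openCell n i
    have : (insert (⟨n, i⟩ : Σ n, RelCWComplex.cell (univ : Set X) n)
        (⋃ m ∈ Iio n, Sigma.mk m '' (I m : Set (RelCWComplex.cell (univ : Set X) m)))).Finite :=
      ((finite_Iio n).biUnion fun m _ => (I m).finite_toSet.image _).insert _
    refine ((this.preimage Subtype.val_injective.injOn).image x).subset ?_
    rintro y ⟨hy, hyi⟩
    obtain ⟨p, rfl⟩ := hT hy
    refine ⟨p, ?_, rfl⟩
    rw [← RelCWComplex.cellFrontier_union_openCell_eq_closedCell] at hyi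
    obtain hyi | hyi := hyi
    · obtain ⟨m, hm, j, hj, hy⟩ := by simpa only [mem_iUnion, exists_prop] using hI hyi
      refine Or.inr ?_
      simp only [mem_iUnion, exists_prop]
      exact ⟨m, hm, j, hj, (inj p (q := ⟨m, j⟩) hy).symm⟩
    · exact Or.inl (inj p (q := ⟨n, i⟩) hyi)
  have hinj : Function.Injective x := fun p q h => Subtype.ext (inj p (h ▸ (hx q).2))
  have := Set.finite_range_iff hinj |>.1 hfin
  exact toFinite F

/-- The inverse of a map which is continuous on the closed unit ball, injective on the open ball
and maps the sphere to the complement of the image of the open ball is continuous. -/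
lemma continuousOn_toPartialEquiv_symm {n : ℕ} {X : Type*} [TopologicalSpace X] [T2Space X]
    {f : (Fin n → ℝ) → X} (hf : ContinuousOn f (closedBall 0 1)) (hinj : InjOn f (ball 0 1))
    (hd : Disjoint (f '' sphere 0 1) (f '' ball 0 1)) :
    ContinuousOn hinj.toPartialEquiv.symm hinj.toPartialEquiv.target := by
  -- The image of a compact set is closed, and by `hd` the boundary sphere contributes nothing to it
  -- inside the image of the open ball.
  refine continuousOn_iff_isClosed.2 fun Z hZ => ⟨f '' (Z ∩ closedBall 0 1), ?_, ?_⟩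
  · exact (((isCompact_closedBall _ _).inter_left hZ).image_of_continuousOn
      (hf.mono inter_subset_right)).isClosed
  · ext P
    constructor
    · rintro ⟨h1, x, hx, rfl⟩
      have := hinj.toPartialEquiv.left_inv hx
      rw [mem_preimage] at h1
      erw [this] at h1
      exact ⟨⟨x, ⟨h1, ball_subset_closedBall hx⟩, rfl⟩, x, hx, rfl⟩
    · rintro ⟨⟨y, hy, hxy⟩, x, hx, rfl⟩
      refine ⟨?_, x, hx, rfl⟩
      have := hinj.toPartialEquiv.left_inv hx
      rw [mem_preimage]
      erw [this]
      have hy' : y ∈ ball (0 : Fin n → ℝ) 1 := by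
        by_contra h
        refine disjoint_left.1 hd ⟨y, ?_, hxy⟩ ⟨x, hx, rfl⟩
        rw [← sphere_union_ball] at hy
        exact hy.2.resolve_right h
      rw [← hinj hy' hx hxy]
      exact hy.1

namespace MapFromCW

variable {φ : MapFromCW.{u}}

/-- The new cells whose interior is met by the attaching map of a given cell. -/
def boundaryCells {n : ℕ} (c : FormalCell φ.A φ.B n) : Set (Σ m, φ.cells m) :=
  {p | ∃ y, c.attach y ∈ range p.2.1.point}

lemma eq_of_mem_range_point {p q : Σ m, φ.cells m} {P : FormalPoint φ.A φ.B}
    (hp : P ∈ range p.2.1.point) (hq : P ∈ range q.2.1.point) : p = q := by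
  obtain ⟨m, ⟨α, β⟩, hc⟩ := p
  obtain ⟨n, ⟨α', β'⟩, hd⟩ := q
  obtain ⟨x, rfl⟩ := hp
  obtain ⟨y, hy⟩ := hq
  injection hy with h1 h2 h3
  subst h1
  cases h2
  cases h3
  rfl

/-- The argument of `finite_setOf_openCell_inter_nonempty` again, before a CW structure on `Total φ`
is available. Closure-finiteness of the lower cells is supplied by strong induction on the
dimension. -/
lemma finite_boundaryCells {n : ℕ} {c : FormalCell φ.A φ.B n} (hc : c ∈ φ.cells n) :
    (boundaryCells c).Finite := by
  induction n using Nat.strong_induction_on with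
  | _ n ih =>
    let _ := cellsTopology φ.cells
    choose y hy using fun p : boundaryCells c => p.2
    have hfin : (range fun p => c.attach (y p)).Finite := by
      refine finite_of_forall_subset_isClosed (isCompact_range (mem_cells_iff.1 hc).1)
        (range_subset_iff.2 fun p => mem_range_self _) fun T hT => ?_
      -- Lying in the stage means that closedness of `T` need only be tested on cells of dimension
      -- less than `n`, which the induction hypothesis covers.
      have hTn : T ∩ φ.stage n = T := by
        refine inter_eq_left.2 fun P hP => ?_
        obtain ⟨p, rfl⟩ := hT hP
        exact attach_mem_stage hc _
      rw [← hTn]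
      refine isClosed_inter_stage (isClosed_cellsTopology_iff.2 ⟨?_, fun m d hd => ?_⟩)
      · convert isClosed_empty
        refine eq_empty_of_forall_notMem fun a ha => ?_
        obtain ⟨p, hp⟩ := hT ha
        obtain ⟨z, hz⟩ := hy p
        cases hz.trans hp
      · have hF : ((fun p => c.attach (y p)) '' (Subtype.val ⁻¹'
            (insert ⟨m, ⟨d, hd.2⟩⟩ (boundaryCells d)))).Finite :=
          (((ih m hd.1 hd.2).insert _).preimage Subtype.val_injective.injOn).image _
        -- Finite sets are closed in the Hausdorff space `Total φ`, so the set is moved there before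
        -- it is pulled back to the disk.
        have hF' : ((Subtype.val : Total φ → _) ⁻¹' (T ∩ _)).Finite :=
          (hF.inter_of_right T).preimage Subtype.val_injective.injOn
        convert! (Finite.isClosed (X := Total φ) hF').preimage (Total.continuous_charMap ⟨d, hd.2⟩) using 1
        ext x
        refine ⟨fun hx => ⟨hx, ?_⟩, fun hx => hx.1⟩
        obtain ⟨p, hp⟩ := hT hx
        refine ⟨p, ?_, hp⟩
        simp only at hp
        obtain ⟨z, rfl⟩ | ⟨z, rfl⟩ := eq_sphere_or_ball x
        · exact Or.inr ⟨z, by rw [← d.charMap_sphere]; exact hp ▸ hy p⟩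
        · exact Or.inl (eq_of_mem_range_point (hy p)
            (by rw [hp]; exact ⟨z, (d.charMap_ball z).symm⟩))
    have hinj : Function.Injective fun p => c.attach (y p) := fun p q h =>
      Subtype.ext (eq_of_mem_range_point (hy p) (by simp only at h; exact h ▸ hy q))
    have := Set.finite_range_iff hinj |>.1 hfin
    exact toFinite _

end MapFromCW

end CellularFactorization

/-! ### The CW structure and the classification of the new cells -/

namespace CellularFactorization

open Metric Set

namespace Total

open MapFromCW

variable {φ : MapFromCW.{u}}

/-- The cells of the total space: the cells of `A` and the new cells. -/
abbrev Cell (φ : MapFromCW.{u}) (n : ℕ) : Type u :=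
  RelCWComplex.cell (univ : Set φ.A) n ⊕ φ.cells n

/-- The characteristic map of a cell of the total space. -/
noncomputable def cellMap {n : ℕ} : Cell φ n → (Fin n → ℝ) → Total φ
  | .inl i => incl φ ∘ RelCWComplex.map n i
  | .inr c => charMap c

lemma continuous_val (φ : MapFromCW.{u}) :
    Continuous[inferInstance, cellsTopology φ.cells] fun P : Total φ => P.1 :=
  @continuous_induced_dom _ _ Subtype.val (cellsTopology φ.cells)

lemma charMap_sphere {n : ℕ} (c : φ.cells n) (x : sphere (0 : Fin n → ℝ) 1) :
    (charMap c x).1 = c.1.attach x := c.1.charMap_sphere x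

lemma charMap_ball {n : ℕ} (c : φ.cells n) (x : ball (0 : Fin n → ℝ) 1) :
    (charMap c x).1 = c.1.point x := c.1.charMap_ball x

lemma continuousOn_cellMap {n : ℕ} (i : Cell φ n) : ContinuousOn (cellMap i) (closedBall 0 1) := by
  cases i with
  | inl i => exact (continuous_incl φ).comp_continuousOn (RelCWComplex.continuousOn n i)
  | inr c => exact continuousOn_iff_continuous_domRestrict.2 (continuous_charMap c)

lemma injOn_cellMap {n : ℕ} (i : Cell φ n) : InjOn (cellMap i) (ball 0 1) := by
  cases i with
  | inl i =>
    refine (incl_injective φ).comp_injOn ?_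
    rw [← RelCWComplex.source_eq n i]
    exact (RelCWComplex.map n i).injOn
  | inr c =>
    intro x hx y hy h
    have := congrArg Subtype.val h
    simp only [cellMap, charMap_ball c ⟨x, hx⟩, charMap_ball c ⟨y, hy⟩] at this
    exact congrArg Subtype.val (c.1.point_injective this)

lemma disjoint_cellMap_sphere_ball {n : ℕ} (i : Cell φ n) :
    Disjoint (cellMap i '' sphere 0 1) (cellMap i '' ball 0 1) := by
  cases i with
  | inl i =>
    simp only [cellMap, image_comp]
    refine (disjoint_image_iff (incl_injective φ)).2 ?_
    exact (RelCWComplex.disjoint_skeletonLT_openCell (n := n) le_rfl).mono_left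
      (RelCWComplex.cellFrontier_subset_skeletonLT n i)
  | inr c =>
    refine disjoint_left.2 ?_
    rintro _ ⟨x, hx, rfl⟩ ⟨y, hy, hxy⟩
    have := congrArg Subtype.val hxy
    simp only [cellMap, charMap_ball c ⟨y, hy⟩, charMap_sphere c ⟨x, hx⟩] at this
    exact attach_ne_point le_rfl c.2 _ _ this.symm

/-- For new cells, an interior point carries the label of its cell; for old cells this is
disjointness of open cells in `A`. -/
lemma eq_of_cellMap_eq {m n : ℕ} {i : Cell φ m} {j : Cell φ n} {x : Fin m → ℝ} {y : Fin n → ℝ}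
    (hx : x ∈ ball 0 1) (hy : y ∈ ball 0 1) (h : cellMap i x = cellMap j y) :
    (⟨m, i⟩ : Σ n, Cell φ n) = ⟨n, j⟩ := by
  obtain i | c := i <;> obtain j | d := j
  · by_contra hne
    have hne' : (⟨m, i⟩ : Σ n, RelCWComplex.cell (univ : Set φ.A) n) ≠ ⟨n, j⟩ := by
      rintro ⟨⟩
      exact hne rfl
    exact disjoint_left.1 (RelCWComplex.disjoint_openCell_of_ne hne') ⟨x, hx, rfl⟩
      ⟨y, hy, (incl_injective φ h).symm⟩
  · have := congrArg Subtype.val h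
    simp only [cellMap, charMap_ball d ⟨y, hy⟩] at this
    cases this
  · have := congrArg Subtype.val h
    simp only [cellMap, charMap_ball c ⟨x, hx⟩] at this
    cases this
  · have := congrArg Subtype.val h
    simp only [cellMap, charMap_ball c ⟨x, hx⟩, charMap_ball d ⟨y, hy⟩] at this
    have := eq_of_mem_range_point (p := ⟨m, c⟩) (q := ⟨n, d⟩) ⟨_, rfl⟩ ⟨_, this.symm⟩
    cases this
    rfl

lemma mem_openCell_of_mem_skel {n : ℕ} {a : φ.A} (ha : a ∈ φ.skel n) :
    ∃ m < n, ∃ i : RelCWComplex.cell (univ : Set φ.A) m, a ∈ RelCWComplex.openCell m i := by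
  simpa using CWComplex.mem_skeletonLT_iff.1 ha

/-- For a new cell the boundary image is compact. Its part in the closed subspace `A` meets finitely
many cells of `A`, and `finite_boundaryCells` handles the new ones; the bound on dimensions is the
cellularity condition on attaching functions. -/
lemma exists_mapsTo_cellMap {n : ℕ} (i : Cell φ n) : ∃ I : Π m, Finset (Cell φ m),
    MapsTo (cellMap i) (sphere 0 1)
      (⋃ (m < n) (j ∈ I m), cellMap j '' closedBall 0 1) := by
  classical
  obtain i | c := i
  · obtain ⟨I, hI⟩ := CWComplex.mapsTo (C := (univ : Set φ.A)) n i
    refine ⟨fun m => (I m).map ⟨Sum.inl, Sum.inl_injective⟩, fun x hx => ?_⟩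
    obtain ⟨m, hm, j, hj, y, hy, h⟩ := by simpa only [mem_iUnion, exists_prop] using hI hx
    simp only [mem_iUnion, exists_prop]
    exact ⟨m, hm, .inl j, Finset.mem_map_of_mem _ hj, y, hy, congrArg (incl φ) h⟩
  · have hK : IsCompact (incl φ ⁻¹' (cellMap (.inr c) '' sphere 0 1)) :=
      (isClosedEmbedding_incl φ).isCompact_preimage ((isCompact_sphere _ _).image_of_continuousOn
        ((continuousOn_cellMap _).mono sphere_subset_closedBall))
    have h1 (m : ℕ) := (finite_setOf_openCell_inter_nonempty hK).preimage
      (sigma_mk_injective (i := m)).injOn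
    have h2 (m : ℕ) := (finite_boundaryCells c.2).preimage (sigma_mk_injective (i := m)).injOn
    refine ⟨fun m => ((h1 m).image Sum.inl).toFinset ∪ ((h2 m).image Sum.inr).toFinset,
      fun x hx => ?_⟩
    have hxs := attach_mem_formalSkeletonLT c.2 ⟨x, hx⟩
    have hxc := charMap_sphere c ⟨x, hx⟩
    simp only [mem_iUnion, exists_prop, Finset.mem_union, Finite.mem_toFinset]
    generalize hP : c.1.attach ⟨x, hx⟩ = P at hxs hxc
    obtain (a | ⟨m, α, β, z⟩) := P
    · obtain ⟨m, hm, i, y, hy, rfl⟩ := mem_openCell_of_mem_skel hxs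
      refine ⟨m, hm, .inl i, Or.inl ⟨i, ⟨RelCWComplex.map m i y, ⟨x, hx, ?_⟩, y, hy, rfl⟩, rfl⟩, y,
        ball_subset_closedBall hy, ?_⟩ <;>
      exact Subtype.ext (by simp [cellMap, hxc, incl])
    · refine ⟨m, hxs.1, .inr ⟨⟨α, β⟩, hxs.2⟩, Or.inr ⟨(⟨⟨α, β⟩, hxs.2⟩ : φ.cells m), ⟨⟨x, hx⟩, z, hP.symm⟩, rfl⟩, z,
        ball_subset_closedBall z.2, Subtype.ext ?_⟩
      exact (charMap_ball _ z).trans hxc.symm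

lemma isClosed_of_inter_cellMap {Z : Set (Total φ)}
    (h : ∀ n (i : Cell φ n), IsClosed (Z ∩ cellMap i '' closedBall 0 1)) : IsClosed Z := by
  refine isClosed_iff.2 ⟨(CWComplex.closed univ _ (subset_univ _)).2 fun n i => ?_, fun n c => ?_⟩
  · convert! (h n (.inl i)).preimage (continuous_incl φ) using 1
    ext a
    simp only [cellMap, image_comp, preimage_inter, preimage_image_eq _ (incl_injective φ)]
    rfl
  · convert (h n (.inr c)).preimage (continuous_charMap c) using 1
    ext x
    exact ⟨fun hx => ⟨hx, x, x.2, rfl⟩, fun hx => hx.1⟩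

lemma exists_mem_cellMap_ball (P : Total φ) : ∃ n, ∃ i : Cell φ n, P ∈ cellMap i '' ball 0 1 := by
  obtain ⟨a | ⟨m, α, β, z⟩, hP⟩ := P
  · have : a ∈ ⋃ (n : ℕ) (j : RelCWComplex.cell (univ : Set φ.A) n), RelCWComplex.openCell n j := by
      rw [CWComplex.iUnion_openCell_eq_complex]
      trivial
    obtain ⟨n, i, y, hy, rfl⟩ := by simpa only [mem_iUnion] using this
    exact ⟨n, .inl i, y, hy, rfl⟩
  · exact ⟨m, .inr ⟨⟨α, β⟩, hP⟩, z, z.2, Subtype.ext (charMap_ball _ z)⟩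

/-- The CW structure on the total space. -/
noncomputable instance : CWComplex (univ : Set (Total φ)) where
  cell := Cell φ
  map n i := (injOn_cellMap i).toPartialEquiv
  source_eq n i := rfl
  continuousOn n i := continuousOn_cellMap i
  continuousOn_symm n i := continuousOn_toPartialEquiv_symm (continuousOn_cellMap i)
    (injOn_cellMap i) (disjoint_cellMap_sphere_ball i)
  pairwiseDisjoint' := by
    rintro ⟨m, i⟩ _ ⟨n, j⟩ _ hne
    refine disjoint_left.2 ?_
    rintro _ ⟨x, hx, rfl⟩ ⟨y, hy, h⟩
    exact hne (eq_of_cellMap_eq hx hy h.symm)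
  mapsTo' n i := exists_mapsTo_cellMap i
  closed' Z _ h := isClosed_of_inter_cellMap h
  union' := by
    refine eq_univ_of_forall fun P => ?_
    obtain ⟨n, i, y, hy, h⟩ := exists_mem_cellMap_ball P
    exact mem_iUnion₂.2 ⟨n, i, y, ball_subset_closedBall hy, h⟩

lemma map_eq_cellMap {n : ℕ} (i : Cell φ n) :
    ⇑(RelCWComplex.map (C := (univ : Set (Total φ))) n i) = cellMap i := rfl

lemma openCell_inl {n : ℕ} (i : RelCWComplex.cell (univ : Set φ.A) n) :
    RelCWComplex.openCell (C := (univ : Set (Total φ))) n (Sum.inl i : Cell φ n) =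
      incl φ '' RelCWComplex.openCell n i :=
  image_comp (incl φ) (RelCWComplex.map n i) (ball 0 1)

lemma isSubcomplexInclusion_incl (φ : MapFromCW.{u}) :
    IsSubcomplexInclusion (⟨incl φ, continuous_incl φ⟩ : C(φ.A, Total φ)) := by
  refine ⟨isClosedEmbedding_incl φ, ⟨range (incl φ), fun n => range Sum.inl,
    (isClosedEmbedding_incl φ).isClosed_range, ?_⟩, rfl,
    fun n => Equiv.ofInjective _ Sum.inl_injective, fun n i x _ => rfl⟩
  rw [empty_union]
  have : range (incl φ) = ⋃ (n : ℕ) (i : RelCWComplex.cell (univ : Set φ.A) n),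
      incl φ '' RelCWComplex.openCell n i := by
    simp only [← image_iUnion, CWComplex.iUnion_openCell_eq_complex, image_univ]
  rw [this]
  refine iUnion_congr fun n => ?_
  rw [iUnion_subtype, biUnion_range]
  exact iUnion_congr fun i => openCell_inl i

/-- Identifies the formal cellularity condition used to define the cells with the one in
`CellularSquare`. -/
lemma mem_skeletonLT_iff {n : ℕ} {P : Total φ} :
    P ∈ (RelCWComplex.skeletonLT (univ : Set (Total φ)) n : Set (Total φ)) ↔
      P.1 ∈ formalSkeletonLT φ.skel φ.cells n := by
  rw [SetLike.mem_coe, CWComplex.mem_skeletonLT_iff]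
  constructor
  · rintro ⟨m, hm, i | c, hP⟩
    · rw [openCell_inl] at hP
      obtain ⟨a, ha, rfl⟩ := hP
      exact CWComplex.mem_skeletonLT_iff.2 ⟨m, hm, i, ha⟩
    · obtain ⟨x, hx, rfl⟩ := hP
      exact charMap_mem_formalSkeletonLT c.2 (by exact_mod_cast hm) x
  · obtain ⟨a | ⟨m, α, β, z⟩, hP⟩ := P
    · intro h
      obtain ⟨m, hm, i, h⟩ := CWComplex.mem_skeletonLT_iff.1 h
      exact ⟨m, hm, .inl i, by rw [openCell_inl]; exact ⟨a, h, rfl⟩⟩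
    · rintro ⟨h, h'⟩
      exact ⟨m, by exact_mod_cast h, .inr ⟨⟨α, β⟩, h'⟩, z, z.2, Subtype.ext (charMap_ball _ z)⟩

lemma disjoint_openCell_inr_range_incl {n : ℕ} (c : φ.cells n) :
    Disjoint (RelCWComplex.openCell (C := (univ : Set (Total φ))) n (Sum.inr c : Cell φ n))
      (range (incl φ)) := by
  refine disjoint_left.2 ?_
  rintro _ ⟨x, hx, rfl⟩ ⟨a, h⟩
  have := congrArg Subtype.val h
  simp only [map_eq_cellMap, cellMap, charMap_ball c ⟨x, hx⟩] at this
  cases this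

lemma exists_eq_inr_of_disjoint {n : ℕ} (i : Cell φ n)
    (h : Disjoint (RelCWComplex.openCell (C := (univ : Set (Total φ))) n i) (range (incl φ))) :
    ∃ c, i = .inr c := by
  obtain i | c := i
  · rw [openCell_inl] at h
    obtain ⟨a, ha⟩ := RelCWComplex.openCell_nonempty n i
    exact absurd (mem_range_self a) (disjoint_left.1 h (mem_image_of_mem _ ha))
  · exact ⟨c, rfl⟩

/-- True by construction: the label of a new cell is its pair of attaching function and disk
function, and `mem_cells_iff` asks exactly for the conditions of a cellular square. Cells with equal
labels are equal. -/
lemma attachesExactlyCellularSquares (φ : MapFromCW.{u}) :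
    AttachesExactlyCellularSquares (⟨incl φ, continuous_incl φ⟩ : C(φ.A, Total φ))
      (⟨proj φ, continuous_proj φ⟩ : C(Total φ, φ.B)) := by
  have attach_iff {n : ℕ} (c : φ.cells n) (s : CellularSquare
      (⟨incl φ, continuous_incl φ⟩ : C(φ.A, Total φ))
      (⟨proj φ, continuous_proj φ⟩ : C(Total φ, φ.B)) n) :
      IsAttachedAlong (.inr c : Cell φ n) s ↔
        (∀ x, c.1.attach x = (s.α x).1.1) ∧ ∀ x, c.1.disk x = s.β x := by
    refine and_congr (forall_congr' fun x => ?_) (forall_congr' fun x => ?_)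
    · rw [map_eq_cellMap, ← charMap_sphere]
      exact Subtype.ext_iff
    · rw [map_eq_cellMap, ← proj_charMap]
      rfl
  refine fun n => ⟨?_, fun s => ?_⟩
  · rintro ⟨i, hi⟩
    obtain ⟨c, rfl⟩ := exists_eq_inr_of_disjoint i hi
    obtain ⟨h1, h2, h3, h4⟩ := mem_cells_iff.1 c.2
    have hmem (x : sphere (0 : Fin n → ℝ) 1) := mem_skeletonLT_iff.2
      (show (charMap c x).1 ∈ formalSkeletonLT φ.skel φ.cells n by rw [charMap_sphere]; exact h3 x)
    refine ⟨⟨⟨fun x => ⟨charMap c x, Or.inr (hmem x)⟩, ?_⟩, ⟨c.1.disk, h2⟩, hmem, fun x => ?_⟩,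
      (attach_iff c _).2 ⟨fun x => (charMap_sphere c x).symm, fun x => rfl⟩, fun s hs => ?_⟩
    · exact ((continuous_charMap c).comp (Topology.IsEmbedding.inclusion
        sphere_subset_closedBall).continuous).subtype_mk _
    · exact (congrArg (FormalPoint.proj φ.f) (charMap_sphere c x)).trans (h4 x)
    · obtain ⟨h, h'⟩ := (attach_iff c _).1 hs
      obtain ⟨α, β, _, _⟩ := s
      congr 1
      · ext x
        exact Subtype.ext ((h x).symm.trans (charMap_sphere c x).symm)
      · ext x
        exact (h' x).symm
  · let c : φ.cells n := ⟨⟨fun x => (s.α x).1.1, s.β⟩, mem_cells_iff.2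
      ⟨?_, s.β.continuous, fun x => mem_skeletonLT_iff.1 (s.cellular x), s.comm⟩⟩
    · refine ⟨⟨.inr c, disjoint_openCell_inr_range_incl c⟩,
        (attach_iff c s).2 ⟨fun x => rfl, fun x => rfl⟩, ?_⟩
      rintro ⟨i, hi⟩ his
      obtain ⟨d, rfl⟩ := exists_eq_inr_of_disjoint i hi
      obtain ⟨h, h'⟩ := (attach_iff d s).1 his
      have : d = c := Subtype.ext (FormalCell.ext (funext h) (funext h'))
      subst this
      rfl
    · let _ := cellsTopology φ.cells
      exact (continuous_val φ).comp (continuous_subtype_val.comp s.α.continuous)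

end Total

end CellularFactorization

/-! ### Cellular approximation for maps from spheres -/

namespace CellularFactorization

open Metric Set unitInterval

section CellularApproximation

variable {X : Type*} [TopologicalSpace X] [T2Space X] [CWComplex (univ : Set X)]

lemma disjoint_map_sphere_ball {N : ℕ} (i : RelCWComplex.cell (univ : Set X) N) :
    Disjoint (RelCWComplex.cellFrontier N i) (RelCWComplex.openCell N i) :=
  (RelCWComplex.disjoint_skeletonLT_openCell (n := N) le_rfl).mono_left
    (RelCWComplex.cellFrontier_subset_skeletonLT N i)

lemma map_eq_map_iff {N : ℕ} {i : RelCWComplex.cell (univ : Set X) N} {x y : Fin N → ℝ}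
    (hx : x ∈ closedBall 0 1) (hy : y ∈ ball 0 1)
    (h : RelCWComplex.map N i x = RelCWComplex.map N i y) : x = y := by
  have hx' : x ∈ ball (0 : Fin N → ℝ) 1 := by
    rw [← sphere_union_ball] at hx
    exact hx.resolve_left fun hx => disjoint_left.1 (disjoint_map_sphere_ball i) ⟨x, hx, rfl⟩
      ⟨y, hy, h.symm⟩
  have := (RelCWComplex.map N i).injOn
  rw [RelCWComplex.source_eq] at this
  exact this hx' hy h

/-- The complement of an open top-dimensional cell is closed. -/
lemma isClosed_skeletonLT_diff_openCell {N : ℕ} (i : RelCWComplex.cell (univ : Set X) N) :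
    IsClosed ((RelCWComplex.skeletonLT (univ : Set X) (N + 1 : ℕ) : Set X) \
      RelCWComplex.openCell N i) := by
  refine CWComplex.isClosed_of_disjoint_openCell_or_isClosed_inter_closedCell (subset_univ _)
    fun m _ j => ?_
  obtain hm | hm := lt_or_ge N m
  · exact .inl ((RelCWComplex.disjoint_skeletonLT_openCell (by exact_mod_cast hm)).mono_left
      sdiff_subset)
  right
  by_cases hij : (⟨m, j⟩ : Σ n, RelCWComplex.cell (univ : Set X) n) = ⟨N, i⟩
  · cases hij
    convert (RelCWComplex.isClosed_cellFrontier (n := N) (i := i)) using 1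
    ext x
    rw [← RelCWComplex.cellFrontier_union_openCell_eq_closedCell]
    constructor
    · rintro ⟨⟨-, h⟩, h' | h'⟩
      exacts [h', absurd h' h]
    · exact fun h => ⟨⟨RelCWComplex.skeletonLT_mono (by exact_mod_cast N.le_succ)
        (RelCWComplex.cellFrontier_subset_skeletonLT N i h),
        disjoint_left.1 (disjoint_map_sphere_ball i) h⟩, .inl h⟩
  · convert (RelCWComplex.isClosed_closedCell (n := m) (i := j)) using 1
    refine inter_eq_right.2 fun x hx => ⟨?_, ?_⟩
    · exact RelCWComplex.skeletonLT_mono (by exact_mod_cast Nat.succ_le_succ hm)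
        (RelCWComplex.closedCell_subset_skeletonLT m j hx)
    · rw [← RelCWComplex.cellFrontier_union_openCell_eq_closedCell] at hx
      obtain hx | hx := hx
      · exact disjoint_left.1 (RelCWComplex.disjoint_skeletonLT_openCell (n := m)
          (by exact_mod_cast hm)) (RelCWComplex.cellFrontier_subset_skeletonLT m j hx)
      · exact disjoint_left.1 (RelCWComplex.disjoint_openCell_of_ne hij) hx

/-- A map from a compact space to a CW complex can be deformed inside of a top-dimensional closed
cell by a deformation of the disk which fixes the boundary. -/
lemma exists_homotopic_of_deformation {S : Type*} [TopologicalSpace S] [CompactSpace S] [T2Space S]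
    {N : ℕ} (i : RelCWComplex.cell (univ : Set X) N) (α : C(S, X))
    (hα : ∀ s, α s ∈ (RelCWComplex.skeletonLT (univ : Set X) (N + 1 : ℕ) : Set X))
    (Ψ : I × S × (Fin N → ℝ) → Fin N → ℝ)
    (hcont : ContinuousOn Ψ {q | q.2.2 ∈ closedBall 0 1 ∧ RelCWComplex.map N i q.2.2 = α q.2.1})
    (hmap : ∀ t s, ∀ x ∈ closedBall (0 : Fin N → ℝ) 1, RelCWComplex.map N i x = α s →
      Ψ (t, s, x) ∈ closedBall 0 1)
    (h₀ : ∀ s, ∀ x ∈ closedBall (0 : Fin N → ℝ) 1, RelCWComplex.map N i x = α s →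
      Ψ (0, s, x) = x)
    (hsphere : ∀ t s, ∀ x ∈ sphere (0 : Fin N → ℝ) 1, RelCWComplex.map N i x = α s →
      Ψ (t, s, x) = x) :
    ∃ α' : C(S, X), α.Homotopic α' ∧
      (∀ s, ∀ x ∈ closedBall (0 : Fin N → ℝ) 1, RelCWComplex.map N i x = α s →
        α' s = RelCWComplex.map N i (Ψ (1, s, x))) ∧
      ∀ s, α s ∉ RelCWComplex.closedCell N i → α' s = α s := by
  classical
  -- The chosen preimage in the disk is unique only over the open cell. Over the frontier the choice
  -- does not matter, because `Ψ` fixes the sphere.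
  let H : I × S → X := fun p => if h : α p.2 ∈ RelCWComplex.closedCell N i then
    RelCWComplex.map N i (Ψ (p.1, p.2, h.choose)) else α p.2
  have hH (t : I) (s : S) (x : Fin N → ℝ) (hx : x ∈ closedBall 0 1)
      (hxs : RelCWComplex.map N i x = α s) : H (t, s) = RelCWComplex.map N i (Ψ (t, s, x)) := by
    have h : α s ∈ RelCWComplex.closedCell N i := ⟨x, hx, hxs⟩
    simp only [H, dif_pos h]
    obtain ⟨hy, hys⟩ := h.choose_spec
    generalize h.choose = y at hy hys ⊢
    rw [← sphere_union_ball] at hx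
    obtain hx | hx := hx
    · have hy' : y ∈ sphere (0 : Fin N → ℝ) 1 := by
        rw [← sphere_union_ball] at hy
        exact hy.resolve_right fun hy => disjoint_left.1 (disjoint_map_sphere_ball i)
          ⟨x, hx, hxs⟩ ⟨_, hy, hys⟩
      rw [hsphere t s x hx hxs, hsphere t s _ hy' hys, hys, hxs]
    · rw [map_eq_map_iff hy hx (hys.trans hxs.symm)]
  have hH' (t : I) (s : S) (hs : α s ∉ RelCWComplex.openCell N i) : H (t, s) = α s := by
    by_cases h : α s ∈ RelCWComplex.closedCell N i
    · rw [← RelCWComplex.cellFrontier_union_openCell_eq_closedCell] at h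
      obtain ⟨x, hx, hxs⟩ := h.resolve_right hs
      rw [hH t s x (sphere_subset_closedBall hx) hxs, hsphere t s x hx hxs, hxs]
    · simp only [H, dif_neg h]
  have hc₁ : ContinuousOn H {p | α p.2 ∈ RelCWComplex.closedCell N i} := by
    rw [continuousOn_iff_continuous_domRestrict]
    -- Continuity is checked on this compact space of all choices of preimages, which maps onto the
    -- domain by a quotient map.
    let P := {q : I × S × closedBall (0 : Fin N → ℝ) 1 // RelCWComplex.map N i q.2.2 = α q.2.1}
    have hΦ : Continuous fun x : closedBall (0 : Fin N → ℝ) 1 => RelCWComplex.map N i x :=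
      continuousOn_iff_continuous_domRestrict.1 (RelCWComplex.continuousOn N i)
    have hP : CompactSpace P := isCompact_iff_compactSpace.1 (IsClosed.isCompact
      (isClosed_eq (hΦ.comp (by fun_prop)) (by fun_prop)))
    let π : P → {p : I × S | α p.2 ∈ RelCWComplex.closedCell N i} :=
      fun q => ⟨(q.1.1, q.1.2.1), ⟨q.1.2.2, q.1.2.2.2, q.2⟩⟩
    have hπ : Continuous π := by fun_prop
    have hq : IsQuotientMap π := by
      refine hπ.isClosedMap.isQuotientMap hπ ?_
      rintro ⟨⟨t, s⟩, x, hx, hxs⟩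
      exact ⟨⟨(t, s, ⟨x, hx⟩), hxs⟩, rfl⟩
    rw [hq.continuous_iff]
    have h1 : Continuous fun q : P => Ψ (q.1.1, q.1.2.1, q.1.2.2) :=
      hcont.comp_continuous (by fun_prop) fun q => ⟨q.1.2.2.2, q.2⟩
    refine ((RelCWComplex.continuousOn N i).comp_continuous h1 fun q =>
      hmap _ _ _ q.1.2.2.2 q.2).congr fun q => ?_
    exact (hH _ _ _ q.1.2.2.2 q.2).symm
  have hc₂ : ContinuousOn H {p | α p.2 ∉ RelCWComplex.openCell N i} := by
    refine ContinuousOn.congr (f := fun p => α p.2) (by fun_prop) fun p hp => hH' _ _ hp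
  have hc : Continuous H := by
    rw [← continuousOn_univ]
    convert hc₁.union_of_isClosed hc₂ ?_ ?_
    · refine (eq_univ_of_forall fun p => ?_).symm
      by_cases h : α p.2 ∈ RelCWComplex.openCell N i
      · exact .inl (RelCWComplex.openCell_subset_closedCell N i h)
      · exact .inr h
    · exact RelCWComplex.isClosed_closedCell.preimage (by fun_prop)
    -- The cell is top-dimensional in the skeleton containing the image of `α`, so the points not
    -- mapped to the open cell form a closed set.
    · convert (isClosed_skeletonLT_diff_openCell i).preimage
        (show Continuous fun p : I × S => α p.2 by fun_prop) using 1
      ext p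
      exact ⟨fun h => ⟨hα _, h⟩, fun h => h.2⟩
  refine ⟨⟨fun s => H (1, s), by fun_prop⟩, ⟨⟨⟨H, hc⟩, fun s => ?_, fun s => rfl⟩⟩,
    fun s => hH 1 s, fun s hs => hH' 1 s fun h => hs
      (RelCWComplex.openCell_subset_closedCell N i h)⟩
  by_cases h : α s ∈ RelCWComplex.closedCell N i
  · obtain ⟨x, hx, hxs⟩ := h
    exact (hH 0 s x hx hxs).trans (by rw [h₀ s x hx hxs, hxs])
  · exact hH' 0 s fun h' => h (RelCWComplex.openCell_subset_closedCell N i h')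

/-- A map to a CW complex which misses an interior point of a top-dimensional cell can be deformed
out of this cell. -/
lemma exists_homotopic_of_notMem_range {S : Type*} [TopologicalSpace S] [CompactSpace S]
    [T2Space S] {N : ℕ} (i : RelCWComplex.cell (univ : Set X) N) (α : C(S, X))
    (hα : ∀ s, α s ∈ (RelCWComplex.skeletonLT (univ : Set X) (N + 1 : ℕ) : Set X))
    {c : Fin N → ℝ} (hc : c ∈ ball 0 1) (hcα : ∀ s, α s ≠ RelCWComplex.map N i c) :
    ∃ α' : C(S, X), α.Homotopic α' ∧
      (∀ s, α s ∈ RelCWComplex.closedCell N i →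
        α' s ∈ (RelCWComplex.skeletonLT (univ : Set X) N : Set X)) ∧
      ∀ s, α s ∉ RelCWComplex.closedCell N i → α' s = α s := by
  have hc1 : ‖c‖ < 1 := by simpa using hc
  -- In the disk `q` vanishes only at `c`, and it is the identity on the sphere, so `q / ‖q‖`
  -- retracts the disk minus `c` onto the sphere. The straight-line homotopy to it only has to stay
  -- in the disk; it may cross `c`.
  let q : (Fin N → ℝ) → Fin N → ℝ := fun x => x - ((1 - ‖x‖) / (1 - ‖c‖)) • c
  have hq : ∀ x ∈ closedBall (0 : Fin N → ℝ) 1, x ≠ c → ‖q x‖ ≠ 0 := by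
    intro x hx hxc h
    have hx1 : ‖x‖ ≤ 1 := by simpa using hx
    set r := (1 - ‖x‖) / (1 - ‖c‖) with hr
    have h1 : x = r • c := sub_eq_zero.1 (norm_eq_zero.1 h)
    have h2 : 0 ≤ r := div_nonneg (by linarith) (by linarith)
    have h3 : ‖x‖ = r * ‖c‖ := by
      conv_lhs => rw [h1, norm_smul, Real.norm_of_nonneg h2]
    have h4 : r * (1 - ‖c‖) = 1 - ‖x‖ := by
      rw [hr, div_mul_cancel₀]
      linarith
    have h5 : r = 1 := by linarith
    exact hxc (by rw [h1, h5, one_smul])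
  have hne (s : S) (x : Fin N → ℝ) (hxs : RelCWComplex.map N i x = α s) : x ≠ c := by
    rintro rfl
    exact hcα s hxs.symm
  have hnorm : ∀ x ∈ closedBall (0 : Fin N → ℝ) 1, x ≠ c → ‖‖q x‖⁻¹ • q x‖ = 1 := by
    intro x hx hxc
    rw [norm_smul, norm_inv, norm_norm, inv_mul_cancel₀ (hq x hx hxc)]
  have hqc : Continuous fun p : I × S × (Fin N → ℝ) => q p.2.2 := by fun_prop
  have hinv : ContinuousOn (fun p : I × S × (Fin N → ℝ) => ‖q p.2.2‖⁻¹)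
      {p | p.2.2 ∈ closedBall 0 1 ∧ RelCWComplex.map N i p.2.2 = α p.2.1} :=
    hqc.norm.continuousOn.inv₀ fun p hp => hq _ hp.1 (hne _ _ hp.2)
  have hcont : ContinuousOn (fun p : I × S × (Fin N → ℝ) =>
      (1 - (p.1 : ℝ)) • p.2.2 + (p.1 : ℝ) • (‖q p.2.2‖⁻¹ • q p.2.2))
      {p | p.2.2 ∈ closedBall 0 1 ∧ RelCWComplex.map N i p.2.2 = α p.2.1} := by
    have h1 : Continuous fun p : I × S × (Fin N → ℝ) => (p.1 : ℝ) := by fun_prop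
    have h2 : Continuous fun p : I × S × (Fin N → ℝ) => p.2.2 := by fun_prop
    exact ((continuous_const.sub h1).smul h2).continuousOn.add
      (h1.continuousOn.smul (hinv.smul hqc.continuousOn))
  obtain ⟨α', h1, h2, h3⟩ := exists_homotopic_of_deformation i α hα
    (fun p => (1 - (p.1 : ℝ)) • p.2.2 + (p.1 : ℝ) • (‖q p.2.2‖⁻¹ • q p.2.2))
    hcont
    (fun t s x hx hxs => convex_closedBall (0 : Fin N → ℝ) 1 hx
      (by simpa using (hnorm x hx (hne s x hxs)).le) (sub_nonneg.2 t.2.2) t.2.1 (by ring))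
    (fun s x hx hxs => by simp)
    (fun t s x hx hxs => by
      have hx1 : ‖x‖ = 1 := by simpa using hx
      simp [q, hx1, ← add_smul])
  refine ⟨α', h1, ?_, h3⟩
  rintro s ⟨x, hx, hxs⟩
  rw [h2 s x hx hxs]
  refine RelCWComplex.cellFrontier_subset_skeletonLT N i ⟨_, ?_, rfl⟩
  simpa using hnorm x hx (hne s x hxs)

/-- The unit sphere of `ℝⁿ` has Hausdorff dimension less than `n`. -/
lemma dimH_sphere_lt {n : ℕ} (hn : 0 < n) : dimH (sphere (0 : Fin n → ℝ) 1) < n := by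
  obtain ⟨k, rfl⟩ := Nat.exists_eq_succ_of_ne_zero hn.ne'
  -- For the supremum norm the sphere is the boundary of a cube, covered by hyperplanes that are
  -- smooth images of `ℝᵏ`.
  have hsub : sphere (0 : Fin (k + 1) → ℝ) 1 ⊆ ⋃ p : Fin (k + 1) × Bool,
      range fun y : Fin k → ℝ => p.1.insertNth (α := fun _ => ℝ) (bif p.2 then 1 else -1) y := by
    intro x hx
    have hx1 : ‖x‖ = 1 := by simpa using hx
    obtain ⟨i, hi⟩ : ∃ i, ‖x i‖ = 1 := by
      by_contra! h
      have : ‖x‖ < 1 := (pi_norm_lt_iff one_pos).2 fun i =>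
        ((norm_le_pi_norm x i).trans hx1.le).lt_of_ne (h i)
      exact this.ne hx1
    refine mem_iUnion.2 ?_
    obtain h | h := eq_or_eq_neg_of_abs_eq (Real.norm_eq_abs _ ▸ hi)
    · exact ⟨(i, true), i.removeNth x, by simp [← h]⟩
    · exact ⟨(i, false), i.removeNth x, by simp [← h]⟩
  refine (dimH_mono hsub).trans_lt ?_
  rw [dimH_iUnion]
  refine lt_of_le_of_lt (b := (k : ENNReal)) (iSup_le fun p => ?_) (by exact_mod_cast k.lt_succ_self)
  refine (ContDiff.dimH_range_le ?_).trans_eq (by simp)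
  refine contDiff_pi.2 fun j => ?_
  induction j using p.1.succAboveCases with
  | x => simpa using contDiff_const
  | p j => simpa using contDiff_apply ℝ ℝ j

/-- A map from the unit sphere of `ℝⁿ` to a CW complex can be deformed inside of a closed cell of
dimension at least `n` to a map which misses an interior point of this cell. -/
lemma exists_homotopic_missing_point {n N : ℕ} (hn : 0 < n) (hnN : n ≤ N)
    (i : RelCWComplex.cell (univ : Set X) N) (α : C(sphere (0 : Fin n → ℝ) 1, X))
    (hα : ∀ s, α s ∈ (RelCWComplex.skeletonLT (univ : Set X) (N + 1 : ℕ) : Set X)) :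
    ∃ α' : C(sphere (0 : Fin n → ℝ) 1, X), α.Homotopic α' ∧
      (∀ s, α s ∈ RelCWComplex.closedCell N i → α' s ∈ RelCWComplex.closedCell N i) ∧
      (∀ s, α s ∉ RelCWComplex.closedCell N i → α' s = α s) ∧
      ∃ c ∈ ball (0 : Fin N → ℝ) 1, ∀ s, α' s ≠ RelCWComplex.map N i c := by
  set Φ := RelCWComplex.map N i with hΦ
  have hinner : closedBall (0 : Fin N → ℝ) (3 / 4) ⊆ ball 0 1 :=
    closedBall_subset_ball (by norm_num)
  -- the points which are mapped to the inner part of the cell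
  let C : Set (sphere (0 : Fin n → ℝ) 1) := {s | α s ∈ Φ '' closedBall 0 (3 / 4)}
  have hC : IsClosed C := ((isCompact_closedBall _ _).image_of_continuousOn
    ((RelCWComplex.continuousOn N i).mono (hinner.trans ball_subset_closedBall))).isClosed.preimage
      α.continuous
  have hv : Continuous fun s : C => Φ.symm (α s.1) := by
    refine (RelCWComplex.continuousOn_symm N i).comp_continuous (by fun_prop) fun s => ?_
    obtain ⟨x, hx, hxs⟩ := s.2
    rw [← hxs]
    exact Φ.map_source (by rw [RelCWComplex.source_eq]; exact hinner hx)
  have hemb : IsClosedEmbedding fun s : C => (s.1 : Fin n → ℝ) :=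
    isClosed_sphere.isClosedEmbedding_subtypeVal.comp hC.isClosedEmbedding_subtypeVal
  -- The disk coordinate of `α`, defined on `C`, is extended to all of `ℝⁿ` and then approximated
  -- within 1/8 by a C¹ map `w`.
  obtain ⟨v, hv'⟩ := ContinuousMap.exists_extension hemb ⟨_, hv⟩
  obtain ⟨w, hw, hwv, -⟩ := v.continuous.exists_contDiff_approx 1
    (ε := fun _ => 1 / 8) continuous_const (fun _ => by norm_num)
  have hws (s) (x : Fin N → ℝ) (hx : ‖x‖ ≤ 3 / 4) (hxs : Φ x = α s) : ‖w s - x‖ < 1 / 8 := by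
    have hs : s ∈ C := ⟨x, by simpa using hx, hxs⟩
    have h1 : v s = x := by
      refine (DFunLike.congr_fun hv' ⟨s, hs⟩).trans ?_
      change Φ.symm (α s) = x
      rw [← hxs]
      exact Φ.left_inv (by rw [RelCWComplex.source_eq]; exact hinner (by simpa using hx))
    rw [← h1, ← dist_eq_norm]
    exact hwv s
  -- A cutoff equal to 1 up to radius 1/2 and to 0 from radius 3/4 on: the deformation replaces the
  -- coordinate by `w` near the centre and does nothing near the boundary.
  let μ : ℝ → ℝ := fun r => max 0 (min 1 (3 - 4 * r))
  have hμ0 (r : ℝ) : 0 ≤ μ r := le_max_left _ _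
  have hμ1 (r : ℝ) : μ r ≤ 1 := max_le zero_le_one (min_le_left _ _)
  have hμ2 (r : ℝ) (hr : 3 / 4 ≤ r) : μ r = 0 :=
    max_eq_left ((min_le_right _ _).trans (by linarith))
  have hμ3 (r : ℝ) (hr : r ≤ 1 / 2) : μ r = 1 := by
    simp only [μ]
    rw [min_eq_left (by linarith), max_eq_right zero_le_one]
  have hμc : Continuous μ := by fun_prop
  let Ψ : I × sphere (0 : Fin n → ℝ) 1 × (Fin N → ℝ) → Fin N → ℝ :=
    fun p => p.2.2 + ((p.1 : ℝ) * μ ‖p.2.2‖) • (w p.2.1 - p.2.2)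
  have hΨ (t : I) (s) (x : Fin N → ℝ) (hx : ‖x‖ ≤ 3 / 4) (hxs : Φ x = α s) :
      ‖Ψ (t, s, x) - x‖ ≤ 1 / 8 := by
    have h1 : |(t : ℝ) * μ ‖x‖| ≤ 1 := by
      rw [abs_of_nonneg (mul_nonneg t.2.1 (hμ0 _))]
      exact mul_le_one₀ t.2.2 (hμ0 _) (hμ1 _)
    simp only [Ψ, add_sub_cancel_left, norm_smul, Real.norm_eq_abs]
    calc _ ≤ 1 * ‖w s - x‖ := by gcongr
      _ ≤ 1 / 8 := by linarith [hws s x hx hxs]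
  have hΨ' (t : I) (s) (x : Fin N → ℝ) (hx : 3 / 4 ≤ ‖x‖) : Ψ (t, s, x) = x := by
    simp [Ψ, hμ2 _ hx]
  have hwc : Continuous w := hw.continuous
  have hmap (t s) (x) (hx : x ∈ closedBall (0 : Fin N → ℝ) 1) (hxs : Φ x = α s) :
      Ψ (t, s, x) ∈ closedBall 0 1 := by
    obtain h | h := le_total ‖x‖ (3 / 4)
    · rw [mem_closedBall_zero_iff]
      have := hΨ t s x h hxs
      have := norm_le_norm_add_norm_sub' (Ψ (t, s, x)) x
      linarith
    · rwa [hΨ' t s x h]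
  obtain ⟨α', h1, h2, h3⟩ := exists_homotopic_of_deformation i α hα Ψ
    (by fun_prop) hmap (fun s x _ _ => by simp [Ψ])
    (fun t s x hx _ => hΨ' t s x (by norm_num [mem_sphere_zero_iff_norm.1 hx]))
  refine ⟨α', h1, ?_, h3, ?_⟩
  · rintro s ⟨x, hx, hxs⟩
    rw [h2 s x hx hxs]
    exact ⟨_, hmap 1 s x hx hxs, rfl⟩
  -- A C¹ map does not raise Hausdorff dimension, and the sphere has dimension less than `n ≤ N`.
  have hdense : Dense (w '' sphere 0 1)ᶜ := hw.contDiffOn.dense_compl_image_of_dimH_lt_finrank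
    convex_univ (subset_univ _) ((dimH_sphere_lt hn).trans_le (by simpa using hnN))
  -- The radius is 3/8 = 1/2 - 1/8: coordinates of norm at least 1/2 move by at most 1/8 and cannot
  -- reach `c`, while the others end on the image of `w`, which misses `c`.
  obtain ⟨c, hcw, hc⟩ := hdense.exists_mem_open (isOpen_ball (x := (0 : Fin N → ℝ)) (ε := 3 / 8))
    (nonempty_ball.2 (by norm_num))
  rw [mem_ball_zero_iff] at hc
  have hc1 : c ∈ ball (0 : Fin N → ℝ) 1 := by
    rw [mem_ball_zero_iff]
    linarith
  refine ⟨c, hc1, fun s hs => ?_⟩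
  by_cases h : α s ∈ RelCWComplex.closedCell N i
  · obtain ⟨x, hx, hxs⟩ := h
    rw [h2 s x hx hxs] at hs
    have hxc := map_eq_map_iff (hmap 1 s x hx hxs) hc1 hs
    obtain h | h := le_total ‖x‖ (3 / 4)
    · obtain h' | h' := le_total ‖x‖ (1 / 2)
      · refine hcw ⟨s, s.2, ?_⟩
        rw [← hxc]
        simp [Ψ, hμ3 _ h']
      · have := hΨ 1 s x h hxs
        rw [hxc] at this
        have := norm_le_norm_add_norm_sub c x
        linarith
    · rw [hΨ' 1 s x h] at hxc
      rw [hxc] at h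
      linarith
  · rw [h3 s h] at hs
    exact h (hs ▸ ⟨c, ball_subset_closedBall hc1, rfl⟩)

/-- A map from the unit sphere of `ℝⁿ` to the `N`-skeleton of a CW complex, `n ≤ N`, can be deformed
out of an open `N`-cell. -/
lemma exists_homotopic_notMem_openCell {n N : ℕ} (hn : 0 < n) (hnN : n ≤ N)
    (i : RelCWComplex.cell (univ : Set X) N) (α : C(sphere (0 : Fin n → ℝ) 1, X))
    (hα : ∀ s, α s ∈ (RelCWComplex.skeletonLT (univ : Set X) (N + 1 : ℕ) : Set X)) :
    ∃ α' : C(sphere (0 : Fin n → ℝ) 1, X), α.Homotopic α' ∧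
      ∀ s, α' s ∈ (RelCWComplex.skeletonLT (univ : Set X) N : Set X) ∨
        (α s ∉ RelCWComplex.openCell N i ∧ α' s = α s) := by
  obtain ⟨α₁, h1, h2, h3, c, hc, hcα⟩ := exists_homotopic_missing_point hn hnN i α hα
  have hα₁ (s) : α₁ s ∈ (RelCWComplex.skeletonLT (univ : Set X) (N + 1 : ℕ) : Set X) := by
    by_cases h : α s ∈ RelCWComplex.closedCell N i
    · exact RelCWComplex.closedCell_subset_skeletonLT N i (h2 s h)
    · exact h3 s h ▸ hα s
  obtain ⟨α₂, h4, h5, h6⟩ := exists_homotopic_of_notMem_range i α₁ hα₁ hc hcα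
  refine ⟨α₂, h1.trans h4, fun s => ?_⟩
  by_cases h : α₁ s ∈ RelCWComplex.closedCell N i
  · exact .inl (h5 s h)
  · have h' : α s ∉ RelCWComplex.closedCell N i := fun h' => h (h2 s h')
    exact .inr ⟨fun h => h' (RelCWComplex.openCell_subset_closedCell N i h),
      (h6 s h).trans (h3 s h')⟩

lemma mem_skeletonLT_or_openCell {N : ℕ} {x : X}
    (hx : x ∈ (RelCWComplex.skeletonLT (univ : Set X) (N + 1 : ℕ) : Set X)) :
    x ∈ (RelCWComplex.skeletonLT (univ : Set X) N : Set X) ∨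
      ∃ i : RelCWComplex.cell (univ : Set X) N, x ∈ RelCWComplex.openCell N i := by
  obtain ⟨m, hm, i, hi⟩ := CWComplex.mem_skeletonLT_iff.1 hx
  obtain hm | rfl := (Nat.le_of_lt_succ (by exact_mod_cast hm : m < N + 1)).lt_or_eq
  · exact .inl (CWComplex.mem_skeletonLT_iff.2 ⟨m, by exact_mod_cast hm, i, hi⟩)
  · exact .inr ⟨i, hi⟩

/-- A map from the unit sphere of `ℝⁿ` to the `N`-skeleton of a CW complex, `n ≤ N`, can be deformed
to the `(N - 1)`-skeleton. -/
lemma exists_homotopic_skeletonLT_of_succ {n N : ℕ} (hn : 0 < n) (hnN : n ≤ N)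
    (α : C(sphere (0 : Fin n → ℝ) 1, X))
    (hα : ∀ s, α s ∈ (RelCWComplex.skeletonLT (univ : Set X) (N + 1 : ℕ) : Set X)) :
    ∃ α' : C(sphere (0 : Fin n → ℝ) 1, X), α.Homotopic α' ∧
      ∀ s, α' s ∈ (RelCWComplex.skeletonLT (univ : Set X) N : Set X) := by
  classical
  -- Induction on the set of `N`-cells that may be met: clearing one cell moves points only into the
  -- lower skeleton, so no other cell is newly entered.
  have key (F : Finset (RelCWComplex.cell (univ : Set X) N)) :
      ∀ α : C(sphere (0 : Fin n → ℝ) 1, X),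
        (∀ s, α s ∈ (RelCWComplex.skeletonLT (univ : Set X) N : Set X) ∨
          ∃ i ∈ F, α s ∈ RelCWComplex.openCell N i) →
        ∃ α' : C(sphere (0 : Fin n → ℝ) 1, X), α.Homotopic α' ∧
          ∀ s, α' s ∈ (RelCWComplex.skeletonLT (univ : Set X) N : Set X) := by
    induction F using Finset.induction_on with
    | empty => exact fun α hα => ⟨α, .refl α, fun s => (hα s).resolve_right (by simp)⟩
    | insert i F _ ih =>
      intro α hα
      obtain ⟨α₁, h1, h2⟩ := exists_homotopic_notMem_openCell hn hnN i α fun s =>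
        (hα s).elim (fun h => RelCWComplex.skeletonLT_mono (by exact_mod_cast N.le_succ) h)
          fun ⟨j, _, h⟩ => RelCWComplex.openCell_subset_skeletonLT N j h
      obtain ⟨α₂, h3, h4⟩ := ih α₁ fun s => by
        obtain h | ⟨h, h'⟩ := h2 s
        · exact .inl h
        · rw [h']
          refine (hα s).imp_right fun ⟨j, hj, hjs⟩ => ⟨j, ?_, hjs⟩
          exact (Finset.mem_insert.1 hj).resolve_left fun hij => h (hij ▸ hjs)
      exact ⟨α₂, h1.trans h3, h4⟩
  have hfin := (finite_setOf_openCell_inter_nonempty (isCompact_range α.continuous)).preimage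
    (sigma_mk_injective (i := N)).injOn
  refine key hfin.toFinset α fun s => (mem_skeletonLT_or_openCell (hα s)).imp_right ?_
  rintro ⟨i, hi⟩
  exact ⟨i, hfin.mem_toFinset.2 ⟨α s, mem_range_self s, hi⟩, hi⟩

/-- Cellular approximation: a map from the unit sphere of `ℝⁿ` to a CW complex is homotopic to a map
to the `(n - 1)`-skeleton. -/
theorem exists_homotopic_skeletonLT {n : ℕ} (α : C(sphere (0 : Fin n → ℝ) 1, X)) :
    ∃ α' : C(sphere (0 : Fin n → ℝ) 1, X), α.Homotopic α' ∧
      ∀ s, α' s ∈ (RelCWComplex.skeletonLT (univ : Set X) n : Set X) := by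
  obtain rfl | hn := n.eq_zero_or_pos
  · exact ⟨α, .refl α, fun s => absurd s.2 (by
      rw [mem_sphere_zero_iff_norm, Subsingleton.elim s.1 0, norm_zero]
      norm_num)⟩
  have key (k : ℕ) : ∀ α : C(sphere (0 : Fin n → ℝ) 1, X),
      (∀ s, α s ∈ (RelCWComplex.skeletonLT (univ : Set X) (n + k : ℕ) : Set X)) →
      ∃ α' : C(sphere (0 : Fin n → ℝ) 1, X), α.Homotopic α' ∧
        ∀ s, α' s ∈ (RelCWComplex.skeletonLT (univ : Set X) n : Set X) := by
    induction k with
    | zero => exact fun α hα => ⟨α, .refl α, hα⟩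
    | succ k ih =>
      intro α hα
      obtain ⟨α₁, h1, h2⟩ := exists_homotopic_skeletonLT_of_succ hn (n.le_add_right k) α hα
      obtain ⟨α₂, h3, h4⟩ := ih α₁ h2
      exact ⟨α₂, h1.trans h3, h4⟩
  -- The compact image meets finitely many cells, so it lies in some finite skeleton and the descent
  -- can start.
  have hfin := (finite_setOf_openCell_inter_nonempty (isCompact_range α.continuous)).image Sigma.fst
  obtain ⟨k, hk⟩ := hfin.bddAbove
  refine key (k + 1) α fun s => ?_
  have : α s ∈ ⋃ (n : ℕ) (j : RelCWComplex.cell (univ : Set X) n), RelCWComplex.openCell n j := by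
    rw [CWComplex.iUnion_openCell_eq_complex]
    trivial
  obtain ⟨m, i, hi⟩ := by simpa only [mem_iUnion] using this
  have hm : m ≤ k := hk ⟨⟨m, i⟩, ⟨α s, mem_range_self s, hi⟩, rfl⟩
  exact CWComplex.mem_skeletonLT_iff.2 ⟨m, by exact_mod_cast (by omega : m < n + (k + 1)), i, hi⟩

end CellularApproximation

end CellularFactorization

/-! ### Lifting disks up to homotopy -/

namespace CellularFactorization

open Metric Set unitInterval

/-- A map on the unit disk and a homotopy of its restriction to the sphere can be glued along the
sphere. -/
lemma exists_collar_extension {n : ℕ} {Y : Type*} [TopologicalSpace Y]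
    (β : C(closedBall (0 : Fin n → ℝ) 1, Y)) (h : C(I × sphere (0 : Fin n → ℝ) 1, Y))
    (h₀ : ∀ s, h (0, s) = β ⟨s, sphere_subset_closedBall s.2⟩) :
    ∃ E : C(Fin n → ℝ, Y), (∀ x : closedBall (0 : Fin n → ℝ) 1, E x = β x) ∧
      ∀ (t : I) (s : sphere (0 : Fin n → ℝ) 1), E ((1 + (t : ℝ)) • (s : Fin n → ℝ)) = h (t, s) := by
  have hmem (x : Fin n → ℝ) (hx : 1 ≤ ‖x‖) : ‖x‖⁻¹ • x ∈ sphere (0 : Fin n → ℝ) 1 := by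
    have : ‖x‖ ≠ 0 := by linarith
    simp [norm_smul, this]
  -- The homotopy is run radially between radius 1 and radius 2; `projIcc` keeps `E` radially
  -- constant beyond.
  let E : (Fin n → ℝ) → Y := fun x =>
    if hx : ‖x‖ ≤ 1 then β ⟨x, mem_closedBall_zero_iff.2 hx⟩ else
      h (projIcc 0 1 zero_le_one (‖x‖ - 1), ⟨‖x‖⁻¹ • x, hmem x (le_of_not_ge hx)⟩)
  have hE₁ (x : Fin n → ℝ) (hx : ‖x‖ ≤ 1) : E x = β ⟨x, mem_closedBall_zero_iff.2 hx⟩ :=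
    dif_pos hx
  have hE₂ (x : Fin n → ℝ) (hx : 1 ≤ ‖x‖) :
      E x = h (projIcc 0 1 zero_le_one (‖x‖ - 1), ⟨‖x‖⁻¹ • x, hmem x hx⟩) := by
    obtain hx' | hx' := hx.eq_or_lt
    · rw [hE₁ x hx'.symm.le]
      have h1 : projIcc (0 : ℝ) 1 zero_le_one (‖x‖ - 1) = 0 := by
        rw [← hx', sub_self]
        exact projIcc_left _
      rw [h1, h₀]
      congr 2
      change x = ‖x‖⁻¹ • x
      rw [← hx', inv_one, one_smul]
    · exact dif_neg hx'.not_ge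
  have hcont : Continuous E := by
    rw [← continuousOn_univ]
    convert ContinuousOn.union_of_isClosed (s := {x | ‖x‖ ≤ 1}) (t := {x | 1 ≤ ‖x‖}) (f := E)
      ?_ ?_ (isClosed_le continuous_norm continuous_const)
      (isClosed_le continuous_const continuous_norm)
    · exact (eq_univ_of_forall fun x => le_total ‖x‖ 1).symm
    · rw [continuousOn_iff_continuous_domRestrict]
      exact (β.continuous.comp (continuous_subtype_val.subtype_mk _)).congr fun x =>
        (hE₁ x x.2).symm
    · rw [continuousOn_iff_continuous_domRestrict]
      have hinv : Continuous fun x : {x : Fin n → ℝ | 1 ≤ ‖x‖} => ‖(x : Fin n → ℝ)‖⁻¹ :=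
        continuous_subtype_val.norm.inv₀ fun x => (zero_lt_one.trans_le x.2).ne'
      have h1 : Continuous fun x : {x : Fin n → ℝ | 1 ≤ ‖x‖} =>
          (⟨‖(x : Fin n → ℝ)‖⁻¹ • (x : Fin n → ℝ), hmem x x.2⟩ : sphere (0 : Fin n → ℝ) 1) :=
        (hinv.smul continuous_subtype_val).subtype_mk _
      have h2 : Continuous fun x : {x : Fin n → ℝ | 1 ≤ ‖x‖} =>
          projIcc (0 : ℝ) 1 zero_le_one (‖(x : Fin n → ℝ)‖ - 1) :=
        continuous_projIcc.comp (continuous_subtype_val.norm.sub continuous_const)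
      exact (h.continuous.comp (h2.prodMk h1)).congr fun x => (hE₂ x x.2).symm
  refine ⟨⟨E, hcont⟩, fun x => hE₁ x (mem_closedBall_zero_iff.1 x.2), fun t s => ?_⟩
  have ht := t.2.1
  have h1 : ‖(1 + (t : ℝ)) • (s : Fin n → ℝ)‖ = 1 + t := by
    rw [norm_smul, mem_sphere_zero_iff_norm.1 s.2, mul_one, Real.norm_of_nonneg (by linarith)]
  refine (hE₂ _ (by rw [h1]; linarith)).trans ?_
  congr 2
  · rw [h1, add_sub_cancel_left, projIcc_val]
  · ext1
    simp only [h1, smul_smul]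
    rw [inv_mul_cancel₀ (by linarith), one_smul]

/-- Disks relative to their boundary spheres can be lifted along `p` up to homotopy. -/
def LiftsDisks {X B : Type*} [TopologicalSpace X] [TopologicalSpace B] (p : C(X, B)) : Prop :=
  ∀ (n : ℕ) (α : C(sphere (0 : Fin n → ℝ) 1, X)) (β : C(closedBall (0 : Fin n → ℝ) 1, B)),
    (∀ s, p (α s) = β ⟨s, sphere_subset_closedBall s.2⟩) →
    ∃ γ : C(closedBall (0 : Fin n → ℝ) 1, X),
      (∀ s : sphere (0 : Fin n → ℝ) 1, γ ⟨s, sphere_subset_closedBall s.2⟩ = α s) ∧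
      (p.comp γ).HomotopicRel β {x | (x : Fin n → ℝ) ∈ sphere 0 1}

/-- The possibility to lift disks up to homotopy only depends on the homotopy class of the
boundary map. -/
lemma exists_lift_of_homotopic {X B : Type*} [TopologicalSpace X] [TopologicalSpace B] (p : C(X, B))
    {n : ℕ} {α α' : C(sphere (0 : Fin n → ℝ) 1, X)} (H : α.Homotopic α')
    (hα' : ∀ β : C(closedBall (0 : Fin n → ℝ) 1, B),
      (∀ s, p (α' s) = β ⟨s, sphere_subset_closedBall s.2⟩) →
      ∃ γ : C(closedBall (0 : Fin n → ℝ) 1, X),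
        (∀ s : sphere (0 : Fin n → ℝ) 1, γ ⟨s, sphere_subset_closedBall s.2⟩ = α' s) ∧
        ∀ x, p (γ x) = β x)
    (β : C(closedBall (0 : Fin n → ℝ) 1, B))
    (hβ : ∀ s, p (α s) = β ⟨s, sphere_subset_closedBall s.2⟩) :
    ∃ γ : C(closedBall (0 : Fin n → ℝ) 1, X),
      (∀ s : sphere (0 : Fin n → ℝ) 1, γ ⟨s, sphere_subset_closedBall s.2⟩ = α s) ∧
      (p.comp γ).HomotopicRel β {x | (x : Fin n → ℝ) ∈ sphere 0 1} := by
  obtain ⟨H⟩ := H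
  -- The disk `β` enlarged by `p ∘ H` has boundary `p ∘ α'` at radius 2, so after rescaling it lifts
  -- strictly to `Φ`. Enlarging `Φ` by the reversed homotopy turns the boundary back into `α`.
  obtain ⟨E, hE₁, hE₂⟩ := exists_collar_extension β (p.comp H.toContinuousMap) (by simpa using hβ)
  have htwo (s : sphere (0 : Fin n → ℝ) 1) :
      (2 : ℝ) • (s : Fin n → ℝ) = (1 + ((1 : I) : ℝ)) • (s : Fin n → ℝ) := by norm_num
  obtain ⟨Φ, hΦ₁, hΦ₂⟩ := hα' ⟨fun x => E ((2 : ℝ) • (x : Fin n → ℝ)), by fun_prop⟩ fun s => by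
    refine Eq.trans ?_ ((congrArg E (htwo s)).trans (hE₂ 1 s)).symm
    simp
  obtain ⟨G, hG₁, hG₂⟩ := exists_collar_extension Φ
    (H.toContinuousMap.comp ⟨fun q : I × sphere (0 : Fin n → ℝ) 1 => (σ q.1, q.2), by fun_prop⟩)
    (fun s => by simp [hΦ₁])
  -- The image of the lift at `x` is `E` at `r x • x`. Up to norm 1/2 the factor is 4, from the two
  -- rescalings; beyond, the radius is `3 - 2‖x‖`, running back from 2 to 1 along the collar.
  -- Contracting `r x • x` linearly to `x` undoes the detour and fixes the sphere, where `r = 1`.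
  let r : (Fin n → ℝ) → ℝ := fun x => 3 / max ‖x‖ (1 / 2) - 2
  have hpos (x : Fin n → ℝ) : max ‖x‖ (1 / 2) ≠ 0 :=
    (lt_max_of_lt_right (by norm_num : (0 : ℝ) < 1 / 2)).ne'
  have hr : Continuous r :=
    (continuous_const.div (continuous_norm.max continuous_const) hpos).sub continuous_const
  have key (x : closedBall (0 : Fin n → ℝ) 1) :
      p (G ((2 : ℝ) • (x : Fin n → ℝ))) = E (r x • (x : Fin n → ℝ)) := by
    have hx1 := mem_closedBall_zero_iff.1 x.2
    obtain hx | hx := le_total ‖(x : Fin n → ℝ)‖ (1 / 2)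
    · have h2 : (2 : ℝ) • (x : Fin n → ℝ) ∈ closedBall (0 : Fin n → ℝ) 1 := by
        rw [mem_closedBall_zero_iff, norm_smul, Real.norm_of_nonneg zero_le_two]
        linarith
      rw [hG₁ ⟨_, h2⟩, hΦ₂]
      simp only [ContinuousMap.coe_mk, smul_smul]
      congr 2
      simp only [r, max_eq_right hx]
      norm_num
    · set ρ := ‖(x : Fin n → ℝ)‖ with hρ
      have hρ0 : ρ ≠ 0 := by linarith
      let s : sphere (0 : Fin n → ℝ) 1 := ⟨ρ⁻¹ • (x : Fin n → ℝ), by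
        rw [mem_sphere_zero_iff_norm, norm_smul, Real.norm_of_nonneg (inv_nonneg.2 (norm_nonneg _)),
          ← hρ, inv_mul_cancel₀ hρ0]⟩
      let t : I := ⟨2 * ρ - 1, by constructor <;> linarith⟩
      have h1 : (2 : ℝ) • (x : Fin n → ℝ) = (1 + (t : ℝ)) • (s : Fin n → ℝ) := by
        simp only [s, t, smul_smul]
        congr 1
        field_simp
        ring
      have h2 : r x • (x : Fin n → ℝ) = (1 + ((σ t : I) : ℝ)) • (s : Fin n → ℝ) := by
        simp only [s, t, r, smul_smul, coe_symm_eq, ← hρ, max_eq_left hx]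
        congr 1
        field_simp
        ring
      rw [h1, h2, hG₂, hE₂]
      rfl
  refine ⟨⟨fun x => G ((2 : ℝ) • (x : Fin n → ℝ)), by fun_prop⟩, fun s => ?_, ⟨⟨⟨⟨fun q =>
    E ((1 - (q.1 : ℝ)) • r q.2 • (q.2 : Fin n → ℝ) + (q.1 : ℝ) • (q.2 : Fin n → ℝ)), ?_⟩,
    fun x => ?_, fun x => ?_⟩, fun t x hx => ?_⟩⟩⟩
  · refine ((congrArg G (htwo s)).trans (hG₂ 1 s)).trans ?_
    simp
  · have : Continuous fun q : I × closedBall (0 : Fin n → ℝ) 1 => r q.2 := by fun_prop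
    fun_prop
  · simpa using (key x).symm
  · simpa using hE₁ x
  · have hx1 := mem_sphere_zero_iff_norm.1 hx
    have hr1 : r x = 1 := by
      simp only [r, hx1]
      norm_num
    have h3 := key x
    rw [hr1, one_smul] at h3
    simp only [ContinuousMap.coe_mk, hr1, one_smul, ← add_smul, sub_add_cancel,
      ContinuousMap.comp_apply]
    exact h3.symm

end CellularFactorization

/-! ### From disk lifting to weak equivalence -/

namespace CellularFactorization

open Metric Set unitInterval

/-- The standard homeomorphism from the cube `[0, 1]ⁿ` to the unit disk of the supremum norm. -/
noncomputable def cubeHomeomorph (n : ℕ) : (Fin n → I) ≃ₜ closedBall (0 : Fin n → ℝ) 1 where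
  toFun t := ⟨fun i => 2 * (t i : ℝ) - 1, by
    rw [mem_closedBall_zero_iff, pi_norm_le_iff_of_nonneg zero_le_one]
    intro i
    have h1 := (t i).2.1
    have h2 := (t i).2.2
    rw [Real.norm_eq_abs, abs_le]
    constructor <;> linarith⟩
  invFun x i := ⟨((x : Fin n → ℝ) i + 1) / 2, by
    have h := (norm_le_pi_norm (x : Fin n → ℝ) i).trans (mem_closedBall_zero_iff.1 x.2)
    rw [Real.norm_eq_abs, abs_le] at h
    constructor <;> linarith [h.1, h.2]⟩
  left_inv t := by
    ext i
    simp
  right_inv x := by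
    ext i
    simp only
    ring
  continuous_toFun := by fun_prop
  continuous_invFun := continuous_pi fun i => 
    ((((continuous_apply i).comp continuous_subtype_val).add continuous_const).div_const 2).subtype_mk _

lemma cubeHomeomorph_mem_sphere_iff {n : ℕ} {t : Fin n → I} :
    (cubeHomeomorph n t : Fin n → ℝ) ∈ sphere 0 1 ↔ t ∈ Cube.boundary (Fin n) := by
  have hle := mem_closedBall_zero_iff.1 (cubeHomeomorph n t).2
  have hi (i : Fin n) : ‖(cubeHomeomorph n t : Fin n → ℝ) i‖ = 1 ↔ t i = 0 ∨ t i = 1 := by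
    change ‖2 * (t i : ℝ) - 1‖ = 1 ↔ _
    rw [Real.norm_eq_abs, abs_eq zero_le_one, or_comm]
    refine or_congr ⟨fun h => Subtype.ext ?_, fun h => ?_⟩ ⟨fun h => Subtype.ext ?_, fun h => ?_⟩
    · simp only [Icc.coe_zero]
      linarith
    · norm_num [h]
    · simp only [Icc.coe_one]
      linarith
    · norm_num [h]
  simp only [Cube.boundary, mem_ofPred_eq, ← hi, mem_sphere_zero_iff_norm]
  constructor
  · intro h
    by_contra! hne
    have : ‖(cubeHomeomorph n t : Fin n → ℝ)‖ < 1 := (pi_norm_lt_iff one_pos).2 fun i =>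
      ((norm_le_pi_norm _ i).trans hle).lt_of_ne (hne i)
    exact this.ne h
  · rintro ⟨i, hi⟩
    exact le_antisymm hle (hi.ge.trans (norm_le_pi_norm _ i))

section

variable {X B : Type*} [TopologicalSpace X] [TopologicalSpace B] {p : C(X, B)}

/-- Cubes relative to their boundaries can be lifted up to homotopy if disks can. -/
lemma LiftsDisks.exists_cube_lift (hp : LiftsDisks p) {n : ℕ} (α : C(Cube.boundary (Fin n), X))
    (β : C(Fin n → I, B)) (h : ∀ s, p (α s) = β s) :
    ∃ γ : C(Fin n → I, X), (∀ s : Cube.boundary (Fin n), γ s = α s) ∧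
      (p.comp γ).HomotopicRel β (Cube.boundary (Fin n)) := by
  let e := cubeHomeomorph n
  have he (s : sphere (0 : Fin n → ℝ) 1) :
      e.symm ⟨s, sphere_subset_closedBall s.2⟩ ∈ Cube.boundary (Fin n) := by
    rw [← cubeHomeomorph_mem_sphere_iff]
    simp [e]
  obtain ⟨γ, h1, ⟨H⟩⟩ := hp n (α.comp ⟨fun s => ⟨e.symm ⟨s, sphere_subset_closedBall s.2⟩, he s⟩,
    by fun_prop⟩) (β.comp ⟨e.symm, e.symm.continuous⟩) fun s => h _
  refine ⟨γ.comp ⟨e, e.continuous⟩, fun s => ?_, ⟨⟨⟨⟨fun q => H (q.1, e q.2), by fun_prop⟩,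
    fun t => ?_, fun t => ?_⟩, fun r t ht => ?_⟩⟩⟩
  · refine (h1 ⟨e s, cubeHomeomorph_mem_sphere_iff.2 s.2⟩).trans (congrArg α (Subtype.ext ?_))
    exact e.symm_apply_apply _
  · simp
  · simp
  · exact H.eq_fst r (cubeHomeomorph_mem_sphere_iff.2 ht)

/-- Two maps from a cube which agree on the boundary are homotopic relative to the boundary if this
holds after composition with a map which lifts disks. -/
lemma LiftsDisks.homotopicRel_of_comp (hp : LiftsDisks p) {n : ℕ} {γ₀ γ₁ : C(Fin n → I, X)}
    (hγ : ∀ t ∈ Cube.boundary (Fin n), γ₀ t = γ₁ t)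
    (h : (p.comp γ₀).HomotopicRel (p.comp γ₁) (Cube.boundary (Fin n))) :
    γ₀.HomotopicRel γ₁ (Cube.boundary (Fin n)) := by
  obtain ⟨H⟩ := h
  -- Coordinate 0 is the time. The jump at time 1/2 is harmless because only the boundary of the
  -- cube is used: there, time 1/2 forces the remaining coordinates into the boundary, where `γ₀`
  -- and `γ₁` agree.
  let a : (Fin (n + 1) → I) → X := fun t =>
    if (t 0 : ℝ) ≤ 1 / 2 then γ₀ (Fin.tail t) else γ₁ (Fin.tail t)
  have htail : Continuous fun t : Fin (n + 1) → I => (Fin.tail t : Fin n → I) :=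
    continuous_pi fun i => continuous_apply _
  have hbd (t : Fin (n + 1) → I) (ht : t ∈ Cube.boundary (Fin (n + 1))) :
      t 0 = 0 ∨ t 0 = 1 ∨ Fin.tail t ∈ Cube.boundary (Fin n) := by
    obtain ⟨i, hi⟩ := ht
    induction i using Fin.cases with
    | zero => tauto
    | succ i => exact .inr (.inr ⟨i, hi⟩)
  have ha : Continuous fun t : Cube.boundary (Fin (n + 1)) => a t := by
    refine Continuous.if_le (γ₀.continuous.comp (htail.comp continuous_subtype_val))
      (γ₁.continuous.comp (htail.comp continuous_subtype_val)) (continuous_subtype_val.comp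
        ((continuous_apply 0).comp continuous_subtype_val)) continuous_const ?_
    intro t ht
    obtain h | h | h := hbd t t.2
    · norm_num [h] at ht
    · norm_num [h] at ht
    · exact hγ _ h
  have hpa : ∀ t : Cube.boundary (Fin (n + 1)), p (a t) = H (t.1 0, Fin.tail t.1) := by
    rintro ⟨t, ht⟩
    simp only [a]
    obtain h | h | h := hbd t ht
    · rw [h, if_pos (by norm_num)]
      exact (H.apply_zero _).symm
    · rw [h, if_neg (by norm_num)]
      exact (H.apply_one _).symm
    · rw [H.eq_fst _ h]
      split_ifs
      · rfl
      · exact congrArg p (hγ _ h).symm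
  obtain ⟨Γ, hΓ, -⟩ := hp.exists_cube_lift (n := n + 1) ⟨_, ha⟩
    ⟨fun t => H (t 0, Fin.tail t), H.continuous.comp ((continuous_apply 0).prodMk htail)⟩ hpa
  have hcons : Continuous fun q : I × (Fin n → I) => (Fin.cons q.1 q.2 : Fin (n + 1) → I) := by
    refine continuous_pi fun i => ?_
    induction i using Fin.cases with
    | zero => exact continuous_fst
    | succ i => exact (continuous_apply i).comp continuous_snd
  have hΓ' (s : I) (t : Fin n → I)
      (h : (Fin.cons s t : Fin (n + 1) → I) ∈ Cube.boundary (Fin (n + 1))) :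
      Γ (Fin.cons s t) = if (s : ℝ) ≤ 1 / 2 then γ₀ t else γ₁ t := hΓ ⟨_, h⟩
  refine ⟨⟨⟨⟨fun q => Γ (Fin.cons q.1 q.2), Γ.continuous.comp hcons⟩, fun t => ?_, fun t => ?_⟩,
    fun s t ht => ?_⟩⟩
  · simp [hΓ' 0 t ⟨0, .inl rfl⟩]
  · refine (hΓ' 1 t ⟨0, .inr rfl⟩).trans (if_neg ?_)
    norm_num
  · obtain ⟨i, hi⟩ := ht
    have hb : (Fin.cons s t : Fin (n + 1) → I) ∈ Cube.boundary (Fin (n + 1)) :=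
      ⟨i.succ, by simpa using hi⟩
    refine (hΓ' s t hb).trans ?_
    split_ifs
    · rfl
    · exact (hγ t ⟨i, hi⟩).symm

/-- A map which lifts disks relative to their boundaries up to homotopy is a weak equivalence. -/
theorem LiftsDisks.isWeakEquivalence (hp : LiftsDisks p) : IsWeakEquivalence p := by
  -- Path components are treated as the case `n = 0`, the cube being a point with empty boundary.
  have hempty : IsEmpty (Cube.boundary (Fin 0)) := ⟨fun ⟨_, i, _⟩ => i.elim0⟩
  refine ⟨⟨?_, ?_⟩, fun n x _ => ⟨?_, ?_⟩⟩
  · rintro ⟨x⟩ ⟨y⟩ h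
    obtain ⟨ω⟩ : Joined (p x) (p y) := Quotient.exact h
    obtain ⟨H⟩ := hp.homotopicRel_of_comp (n := 0) (γ₀ := .const _ x) (γ₁ := .const _ y)
      (fun t ht => hempty.elim ⟨t, ht⟩)
      ⟨⟨⟨ω.toContinuousMap.comp ⟨Prod.fst, continuous_fst⟩, fun t => by simp, fun t => by simp⟩,
        fun s t ht => hempty.elim ⟨t, ht⟩⟩⟩
    exact Quotient.sound ⟨H.toHomotopy.evalAt 0⟩
  · rintro ⟨b⟩
    obtain ⟨γ, -, ⟨H⟩⟩ := hp.exists_cube_lift (n := 0) ⟨fun s => hempty.elim s,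
      continuous_of_discreteTopology⟩ (.const _ b) fun s => hempty.elim s
    exact ⟨Quotient.mk _ (γ 0), Quotient.sound ⟨H.toHomotopy.evalAt 0⟩⟩
  · rintro ⟨γ₀⟩ ⟨γ₁⟩ h
    refine Quotient.sound (hp.homotopicRel_of_comp (fun t ht => ?_) (Quotient.exact h))
    exact (γ₀.2 t ht).trans (γ₁.2 t ht).symm
  · rintro ⟨β⟩
    obtain ⟨γ, h1, h2⟩ := hp.exists_cube_lift (.const _ x) β.1 fun s => (β.2 s s.2).symm
    exact ⟨Quotient.mk _ ⟨γ, fun t ht => h1 ⟨t, ht⟩⟩, Quotient.sound h2⟩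

/-- If `X` arises from `A` by attaching cells along all cellular squares, then its projection lifts
disks. -/
lemma AttachesExactlyCellularSquares.liftsDisks {A : Type*} [TopologicalSpace A] [T2Space X]
    [CWComplex (univ : Set X)] {j : C(A, X)} (h : AttachesExactlyCellularSquares j p) :
    LiftsDisks p := by
  intro n α β hαβ
  obtain ⟨α', H, hα'⟩ := exists_homotopic_skeletonLT α
  refine exists_lift_of_homotopic p H (fun β hβ => ?_) β hαβ
  -- The deformed boundary and the disk form a cellular square, and the characteristic map of the
  -- cell attached along it is the lift.
  obtain ⟨i, ⟨hi₁, hi₂⟩, -⟩ := (h n).2 ⟨⟨fun s => ⟨α' s, .inr (hα' s)⟩, by fun_prop⟩, β, hα', hβ⟩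
  exact ⟨⟨fun x => RelCWComplex.map n i.1 x, continuousOn_iff_continuous_domRestrict.1
    (RelCWComplex.continuousOn n i.1)⟩, hi₁, hi₂⟩

end

end CellularFactorization

theorem theorem2p2 :
    ∃ (F : CellularFactorization.MapFromCW.{u} ⥤ TopCat.{u})
      (j : CellularFactorization.domFunctor.{u} ⟶ F)
      (p : F ⟶ CellularFactorization.codFunctor.{u}),
      j ≫ p = CellularFactorization.tautological.{u} ∧
      ∀ φ : CellularFactorization.MapFromCW.{u},
        CellularFactorization.IsWeakEquivalence (CellularFactorization.toB (p.app φ)) ∧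
        ∃ (_ : T2Space (F.obj φ)) (_ : CWComplex (Set.univ : Set (F.obj φ))),
          CellularFactorization.IsSubcomplexInclusion
            (CellularFactorization.fromA (j.app φ)) ∧
          CellularFactorization.AttachesExactlyCellularSquares
            (CellularFactorization.fromA (j.app φ))
            (CellularFactorization.toB (p.app φ)) := by
  refine ⟨CellularFactorization.Total.functor, CellularFactorization.Total.inclusion,
    CellularFactorization.Total.projection,
    CellularFactorization.Total.inclusion_comp_projection, fun φ => ?_⟩
  have h := CellularFactorization.Total.attachesExactlyCellularSquares φ
  exact ⟨h.liftsDisks.isWeakEquivalence,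
    (inferInstance : T2Space (CellularFactorization.Total φ)),
    (inferInstance : CWComplex (Set.univ : Set (CellularFactorization.Total φ))),
    CellularFactorization.Total.isSubcomplexInclusion_incl φ, h⟩
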